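/- Let $\mathcal X$ (environment) and $\mathcal Y$ (agent) be finite disjoint sets of propositions. LTL$_f$ formulas over $\mathcal X\cup\mathcal Y$ (built from $\mathrm{true}$, atoms, $\neg$, $\wedge$, strong next, until) are interpreted over finite non-empty traces. A formula $\varphi$ is *realizable* if there is $g:(2^{\mathcal X})^*\to 2^{\mathcal Y}$ such that for every $X_0X_1\cdots\in(2^{\mathcal X})^\omega$ there is $k\ge 0$ with $(X_0\cup g(\epsilon))(X_1\cup g(X_0))\cdots(X_k\cup g(X_0\cdots X_{k-1}))\models\varphi$. For a finite DFA $G=(2^{\mathcal X\cup\mathcal Y},S,init,\delta,F)$, a state $s$ is *agent-winning* if some strategy $g:(2^{\mathcal X})^*\to2^{\mathcal Y}$ is such that every infinite play from $s$ consistent with $g$ contains a state of $F$ (possibly $s$ itself); $\mathrm{awin}(G)$ is the set of agent-winning states. For $W\subseteq S$ let $R(G,W)$ be the DFA with states $W\cup\{ew\}$, accepting states $F\cap W$, initial state $init$ (or $ew$ if $init\notin W$), and $\delta'(s,X\cup Y)=\delta(s,X\cup Y)$ if $s\ne ew$ and $\delta(s,X'\cup Y)\in W$ for every $X'\subseteq\mathcal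 X$, and $\delta'(s,X\cup Y)=ew$ otherwise. The *agent-winning region* is $\mathrm{awr}(G)=R(G,\mathrm{awin}(G))$. *Minimizing* a DFA means removing the unreachable states and merging states from which the same words are accepted; a minimized region remembers which of its states (if any) is the class of $ew$. Products $G_1\times G_2$ of DFAs are the usual ones, accepting in $F_1\times F_2$. **Procedure Compose$(A,G_2)$** (incremental), for a finite DFA $A$ with marked states "$ew$" and a finite DFA $G_2$. Start with empty sets $awin$, $ewin$, $undet$ of states of $A\times G_2$ and run DFSearch on $(init_A,init_2)$. If $(init_A,init_2)\in awin$ afterwards, build $D=R(A\times G_2,awin)$ and return the minimization of $D$; otherwise return Null. DFSearch$(s)$ with $s=(s_1,s_2)$: return at once if $s\in awin\cup ewin\cup undet$. If $s$ is accepting, insert it into $awin$. Insert $s$ into $undet$. Run, in any order, through all $Y\subseteq\mathcal Y$ except those for which $\delta_A(s_1,X\cup Y)$ is marked $ew$ for some $X$. For each such $Y$ run, in any order, through the $X\subseteq\mathcal X$: let $s'=(\delta_A(s_1,X\cup Y),\delta_2(s_2,X\cup Y))$, call DFSearch$(s')$, and break off the loop over $X$ if $s'\in ewin$. If the loop over $X$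 was not broken off and at no $X$ was the successor in $undet$ right after its call, move $s$ from $undet$ to $awin$ (and continue with the next $Y$). After the loop over $Y$, if the loop over $X$ was broken off for every $Y$ considered and $s\notin awin$, move $s$ from $undet$ to $ewin$. Finally, if $s$ is the first-discovered state of its strongly connected component $C$ in the graph of transitions explored so far, perform a backward search in $U=C\cap undet$: repeatedly insert into $awin$ every $s=(s_1,s_2)\in U$ that has a non-excluded $Y$ all of whose successors $(\delta_A(s_1,X\cup Y),\delta_2(s_2,X\cup Y))$, $X\subseteq\mathcal X$, are in $awin$, until nothing changes; then insert into $ewin$ the states of $U$ that are not in $awin$, and remove $U$ from $undet$. **Lemma.** Let $\psi_1,\psi_2$ be LTL$_f$ formulas over $\mathcal X\cup\mathcal Y$ and let $G_1,G_2$ be finite DFAs such that $G_i$ accepts exactly those non-empty traces that satisfy $\psi_i$; assume that the initial states of $G_1$ and $G_2$ are not both accepting. Let $A$ be $\mathrm{awr}(G_1)$ or, more generally, any finite DFA with marked states whose minimization is isomorphic to that of $\mathrm{awr}(G_1)$ (for instance that minimization itself). Then, for all orders in which the loops are run through, Compose$(A,G_2)$ terminates, and 1. if $\psi_1\wedge\psi_2$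 is realizable, it returns (up to isomorphism) the minimization of $\mathrm{awr}(G_1\times G_2)$; 2. if $\psi_1\wedge\psi_2$ is not realizable, it returns Null; 3. if $A=\mathrm{awr}(G_1)$ and $\psi_1\wedge\psi_2$ is realizable, then the region $D$ built before minimization is, up to isomorphism, $\mathrm{awr}(G_1\times G_2)$ with some of its unreachable states removed. -/

import Mathlib

universe u v w x

noncomputable section

namespace LTLfSynthesis

open scoped Classical

/-! ### LTLf syntax and semantics -/

/-- LTLf formulas over a set `P` of atomic propositions. -/
inductive LTLf (P : Type u) : Type u
  | tt : LTLf P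
  | atom : P → LTLf P
  | neg : LTLf P → LTLf P
  | and : LTLf P → LTLf P → LTLf P
  | next : LTLf P → LTLf P
  | until : LTLf P → LTLf P → LTLf P

/-- `Sat ρ φ`: the finite trace `ρ` satisfies `φ`. The suffix `ρ_i` is `ρ.drop i`.
Traces are non-empty; the value on the empty list is never used. -/
def Sat {P : Type u} : List (Finset P) → LTLf P → Prop
  | _, .tt => True
  | ρ, .atom p => ∃ σ, ρ.head? = some σ ∧ p ∈ σ
  | ρ, .neg φ => ¬ Sat ρ φ
  | ρ, .and φ ψ => Sat ρ φ ∧ Sat ρ ψ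
  | ρ, .next φ => 1 < ρ.length ∧ Sat (ρ.drop 1) φ
  | ρ, .until φ ψ =>
      ∃ i, i < ρ.length ∧ Sat (ρ.drop i) ψ ∧ ∀ j, j < i → Sat (ρ.drop j) φ

/-! ### Synthesis (the agent moves first)

`I` is the finite set of input variables (environment), `O` the finite set of output variables (agent). The two
sets are disjoint, so the set of all propositions is `I ⊕ O`. -/

variable {I : Type u} {O : Type v}

/-- The letter `X ∪ Y`. -/
def letter (X : Finset I) (Y : Finset O) : Finset (I ⊕ O) := X.disjSum Y

/-- Agent strategies `(2^I)^* → 2^O`. -/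
abbrev Strategy (I : Type u) (O : Type v) := List (Finset I) → Finset O

/-- The history `X_0 X_1 ⋯ X_{k-1}`. -/
def history (lam : ℕ → Finset I) (k : ℕ) : List (Finset I) := (List.range k).map lam

/-- The trace `(X_0 ∪ g(ε)) (X_1 ∪ g(X_0)) ⋯ (X_k ∪ g(X_0 ⋯ X_{k-1}))`. -/
def trace (g : Strategy I O) (lam : ℕ → Finset I) (k : ℕ) : List (Finset (I ⊕ O)) :=
  (List.range (k + 1)).map fun i => letter (lam i) (g (history lam i))

/-- `g` is a winning strategy for the specification `(φ, I, O)`. -/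
def IsWinningStrategy (φ : LTLf (I ⊕ O)) (g : Strategy I O) : Prop :=
  ∀ lam : ℕ → Finset I, ∃ k : ℕ, Sat (trace g lam k) φ

/-- The specification `(φ, I, O)` is realizable. -/
def Realizable (φ : LTLf (I ⊕ O)) : Prop := ∃ g : Strategy I O, IsWinningStrategy φ g

/-- `G` recognizes the language of `φ`, a set of non-empty traces. -/
def Recognizes {S : Type w} (G : DFA (Finset (I ⊕ O)) S) (φ : LTLf (I ⊕ O)) : Prop :=
  ∀ ρ : List (Finset (I ⊕ O)), ρ ≠ [] → (ρ ∈ G.accepts ↔ Sat ρ φ)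

/-! ### DFA games -/

/-- The infinite play `τ` is consistent with the agent strategy `g`. -/
def Consistent {S : Type w} (G : DFA (Finset (I ⊕ O)) S) (g : Strategy I O) (τ : ℕ → S) : Prop :=
  ∃ lam : ℕ → Finset I, ∀ i, τ (i + 1) = G.step (τ i) (letter (lam i) (g (history lam i)))

/-- Environment-winning plays: infinite plays that contain no accepting state. -/
def EnvWinningPlay {S : Type w} (G : DFA (Finset (I ⊕ O)) S) (τ : ℕ → S) : Prop :=
  ∀ i, τ i ∉ G.accept

/-- `g` is an agent-winning strategy from the state `s`. -/
def AgentWinningFrom {S : Type w} (G : DFA (Finset (I ⊕ O)) S) (g : Strategy I O) (s : S) : Prop :=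
  ¬ ∃ τ : ℕ → S, τ 0 = s ∧ Consistent G g τ ∧ EnvWinningPlay G τ

/-- The set of agent-winning states. -/
def awin {S : Type w} (G : DFA (Finset (I ⊕ O)) S) : Set S :=
  {s | ∃ g : Strategy I O, AgentWinningFrom G g s}

/-! ### Regions -/

/-- A finite DFA in which the states that stand for `ew` are marked. (There may be none: `ew` can
be unreachable and then disappears under minimization.) -/
structure Region (I : Type u) (O : Type v) : Type (max u v (w + 1)) where
  State : Type w
  finite : Finite State
  dfa : DFA (Finset (I ⊕ O)) State
  ew : Set State

/-- The region with states `W ∪ {ew}`, where `ew` is `none`. A transition out of `s ∈ W` under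
`X ∪ Y` is that of `G` if, for every `X'`, the successor of `s` under `X' ∪ Y` is in `W`, and leads
to `ew` otherwise. -/
def regionOf {S : Type w} [Finite S] (G : DFA (Finset (I ⊕ O)) S) (W : Set S) :
    Region.{u, v, w} I O where
  State := Option W
  finite := inferInstance
  dfa :=
    { step := fun p a => p.bind fun s =>
        if h : ∀ X' : Finset I, G.step s (letter X' a.toRight) ∈ W then
          some ⟨G.step s a, by
            have := h a.toLeft
            rwa [letter, Finset.toLeft_disjSum_toRight] at this⟩
        else none
      start := if h : G.start ∈ W then some ⟨G.start, h⟩ else none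
      accept := {p | ∃ s : W, p = some s ∧ (s : S) ∈ G.accept} }
  ew := {none}

/-- The agent-winning region of a DFA game. -/
def awr {S : Type w} [Finite S] (G : DFA (Finset (I ⊕ O)) S) : Region.{u, v, w} I O :=
  regionOf G (awin G)

namespace Region

/-- Isomorphism of regions: a bijection between the states that respects the initial states, the
transitions, the accepting states and `ew`. -/
def Iso (A : Region.{u, v, w} I O) (B : Region.{u, v, x} I O) : Prop :=
  ∃ e : A.State ≃ B.State, e A.dfa.start = B.dfa.start ∧
    (∀ s a, e (A.dfa.step s a) = B.dfa.step (e s) a) ∧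
    (∀ s, e s ∈ B.dfa.accept ↔ s ∈ A.dfa.accept) ∧
    (∀ s, e s ∈ B.ew ↔ s ∈ A.ew)

/-- `A` is (isomorphic to) a part of `B` that contains the initial state of `B` and is closed under
the transitions of `B`; in other words, `A` is `B` without some unreachable states. -/
def Embeds (A : Region.{u, v, w} I O) (B : Region.{u, v, x} I O) : Prop :=
  ∃ f : A.State → B.State, Function.Injective f ∧ f A.dfa.start = B.dfa.start ∧
    (∀ s a, f (A.dfa.step s a) = B.dfa.step (f s) a) ∧
    (∀ s, f s ∈ B.dfa.accept ↔ s ∈ A.dfa.accept) ∧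
    (∀ s, f s ∈ B.ew ↔ s ∈ A.ew)

/-- The reachable states. -/
def Reachable (A : Region.{u, v, w} I O) : Type w :=
  {s : A.State // ∃ ρ : List (Finset (I ⊕ O)), A.dfa.eval ρ = s}

/-- Two reachable states are equivalent if the same words are accepted from them. -/
def nerode (A : Region.{u, v, w} I O) : Setoid A.Reachable :=
  Setoid.ker fun s => A.dfa.acceptsFrom s.1

/-- DFA minimization: remove the unreachable states and merge equivalent states. -/
def minimize (A : Region.{u, v, w} I O) : Region.{u, v, w} I O where
  State := Quotient A.nerode
  finite := by
    have := A.finite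
    have : Finite A.Reachable := Subtype.finite
    exact Quotient.finite _
  dfa :=
    { step := fun q a => Quotient.map (sa := A.nerode) (sb := A.nerode)
        (fun s : A.Reachable => (⟨A.dfa.step s.1 a, by
          obtain ⟨ρ, hρ⟩ := s.2
          exact ⟨ρ ++ [a], by rw [DFA.eval_append_singleton, hρ]⟩⟩ : A.Reachable))
        (by
          intro s t hst
          change A.dfa.acceptsFrom s.1 = A.dfa.acceptsFrom t.1 at hst
          change A.dfa.acceptsFrom _ = A.dfa.acceptsFrom _
          ext ρ
          have := Set.ext_iff.mp hst (a :: ρ)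
          exact this) q
      start := Quotient.mk A.nerode ⟨A.dfa.start, [], rfl⟩
      accept := {q | ∃ s : A.Reachable, q = Quotient.mk A.nerode s ∧ s.1 ∈ A.dfa.accept} }
  ew := {q | ∃ s : A.Reachable, q = Quotient.mk A.nerode s ∧ s.1 ∈ A.ew}

end Region

/-! ### The incremental composition procedure

The states of `G` (the DFA of the second formula) are accessed only through its initial state, its
transition function (`GetSuccessor`) and its acceptance test (`IsAccepting`). -/

/-- The variables of the search: the three sets of states and, for the computation of strongly
connected components, the transitions explored so far and the discovery times. -/
structure SearchState (S : Type w) : Type w where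
  awinState : Set S
  ewinState : Set S
  undetermined : Set S
  edges : Set (S × S)
  disc : S → ℕ
  clock : ℕ

namespace SearchState

variable {S : Type w}

/-- All sets are empty at the beginning. -/
def init : SearchState S := ⟨∅, ∅, ∅, ∅, fun _ => 0, 0⟩

/-- `s` gets the next discovery time. -/
def discover (st : SearchState S) (s : S) : SearchState S :=
  { st with disc := Function.update st.disc s st.clock, clock := st.clock + 1 }

def insertAwin (st : SearchState S) (s : S) : SearchState S :=
  { st with awinState := insert s st.awinState }

def insertEwin (st : SearchState S) (s : S) : SearchState S :=
  { st with ewinState := insert s st.ewinState }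

def insertUndetermined (st : SearchState S) (s : S) : SearchState S :=
  { st with undetermined := insert s st.undetermined }

def removeUndetermined (st : SearchState S) (s : S) : SearchState S :=
  { st with undetermined := st.undetermined \ {s} }

def addEdge (st : SearchState S) (s t : S) : SearchState S :=
  { st with edges := insert (s, t) st.edges }

/-- `t` can be reached from `s` through explored transitions. -/
def Reach (st : SearchState S) : S → S → Prop :=
  Relation.ReflTransGen fun s t => (s, t) ∈ st.edges

/-- `GetScc`: the strongly connected component of `s` in the explored graph. -/
def scc (st : SearchState S) (s : S) : Set S := {t | st.Reach s t ∧ st.Reach t s}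

/-- `IsSccRoot`: `s` was discovered first among the states of its component. -/
def IsSccRoot (st : SearchState S) (s : S) : Prop := ∀ t ∈ st.scc s, st.disc s ≤ st.disc t

end SearchState

section Algorithm

variable (A : Region.{u, v, w} I O) {S₂ : Type w} (G : DFA (Finset (I ⊕ O)) S₂)

/-- The agent choices that allow the environment to reach `ew`. -/
def ewinAgentChoices (s₁ : A.State) : Set (Finset O) :=
  {Y | ∃ X : Finset I, A.dfa.step s₁ (letter X Y) ∈ A.ew}

/-- The pair `(s₁', s₂')` of successors under `X ∪ Y`. -/
def succ (s : A.State × S₂) (X : Finset I) (Y : Finset O) : A.State × S₂ :=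
  (A.dfa.step s.1 (letter X Y), G.step s.2 (letter X Y))

/-- One round of the backward search in a set `scc`: the undetermined states of `scc` become
agent-winning from which some agent choice, whatever the environment does, leads to states already
known to be agent-winning. -/
def backwardStep (U W : Set (A.State × S₂)) : Set (A.State × S₂) :=
  W ∪ {s ∈ U | ∃ Y, Y ∉ ewinAgentChoices A s.1 ∧ ∀ X : Finset I, succ A G s X Y ∈ W}

/-- `BackwardSearch`: repeat the backward step until nothing changes; the states of `scc` that are
then still undetermined are environment-winning. -/
def backwardSearch (scc : Set (A.State × S₂)) (st : SearchState (A.State × S₂)) :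
    SearchState (A.State × S₂) :=
  let U := scc ∩ st.undetermined
  let W := ⋃ n : ℕ, (backwardStep A G U)^[n] st.awinState
  { st with
    awinState := W
    ewinState := st.ewinState ∪ (U \ W)
    undetermined := st.undetermined \ U }

/-- The loop over the environment choices `X`, for fixed `s` and `Y`. `rec` is the recursive call.
Returns the new search state with the flags `ewin_for_some_X` and `undetermined_for_some_X` (the
argument `und` is the current value of the latter). -/
def loopX (rec : A.State × S₂ → SearchState (A.State × S₂) → Option (SearchState (A.State × S₂)))
    (s : A.State × S₂) (Y : Finset O) :
    List (Finset I) → SearchState (A.State × S₂) → Bool →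
      Option (SearchState (A.State × S₂) × Bool × Bool)
  | [], st, und => some (st, false, und)
  | X :: Xs, st, und =>
      (rec (succ A G s X Y) (st.addEdge s (succ A G s X Y))).bind fun st' =>
        if succ A G s X Y ∈ st'.ewinState then some (st', true, und)
        else if succ A G s X Y ∈ st'.undetermined then loopX rec s Y Xs st' true
        else loopX rec s Y Xs st' und

/-- The loop over the agent choices `Y`, for fixed `s`. Returns the new search state with the flag
`ewin_for_all_Y` (the argument `ewinAll` is its current value). -/
def loopY (rec : A.State × S₂ → SearchState (A.State × S₂) → Option (SearchState (A.State × S₂)))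
    (ordX : A.State × S₂ → Finset O → List (Finset I)) (s : A.State × S₂) :
    List (Finset O) → SearchState (A.State × S₂) → Bool →
      Option (SearchState (A.State × S₂) × Bool)
  | [], st, ewinAll => some (st, ewinAll)
  | Y :: Ys, st, ewinAll =>
      (loopX A G rec s Y (ordX s Y) st false).bind fun r =>
        if r.2.1 then loopY rec ordX s Ys r.1 ewinAll
        else if r.2.2 then loopY rec ordX s Ys r.1 false
        else loopY rec ordX s Ys ((r.1.removeUndetermined s).insertAwin s) false

/-- The procedure `DFSearch`. `ordY s` and `ordX s Y` are the orders in which the loops run through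
`2^O` and `2^I`. The natural number bounds the recursion depth; `none` means that the bound was
exceeded. -/
def dfSearch (ordY : A.State × S₂ → List (Finset O))
    (ordX : A.State × S₂ → Finset O → List (Finset I)) :
    ℕ → A.State × S₂ → SearchState (A.State × S₂) → Option (SearchState (A.State × S₂))
  | 0, _, _ => none
  | n + 1, s, st =>
      if s ∈ st.awinState ∪ st.ewinState ∪ st.undetermined then some st
      else
        let st₀ := st.discover s
        let st₁ := if s.1 ∈ A.dfa.accept ∧ s.2 ∈ G.accept then st₀.insertAwin s else st₀
        let st₂ := st₁.insertUndetermined s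
        (loopY A G (dfSearch ordY ordX n) ordX s
            ((ordY s).filter fun Y => Y ∉ ewinAgentChoices A s.1) st₂ true).bind fun r =>
          let st₃ := r.1
          let st₄ := if r.2 = true ∧ s ∉ st₃.awinState then
            (st₃.removeUndetermined s).insertEwin s else st₃
          some (if st₄.IsSccRoot s then backwardSearch A G (st₄.scc s) st₄ else st₄)

/-- `BuildAwr`: the agent-winning region of the product game, built from the set of agent-winning
states found by the search. -/
def buildAwr [Finite S₂] (W : Set (A.State × S₂)) : Region.{u, v, w} I O :=
  haveI := A.finite
  regionOf (A.dfa.inter G) W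

/-- The procedure up to the final minimization. The outer `none` means that the bound `n` on the
recursion depth was exceeded, `some none` is the answer `Null`. -/
def composeBuild [Finite S₂] (ordY : A.State × S₂ → List (Finset O))
    (ordX : A.State × S₂ → Finset O → List (Finset I)) (n : ℕ) :
    Option (Option (Region.{u, v, w} I O)) :=
  (dfSearch A G ordY ordX n (A.dfa.start, G.start) SearchState.init).map fun st =>
    if (A.dfa.start, G.start) ∈ st.awinState then some (buildAwr A G st.awinState) else none

/-- The incremental `Compose` procedure; the region that is returned is minimized. -/
def compose [Finite S₂] (ordY : A.State × S₂ → List (Finset O))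
    (ordX : A.State × S₂ → Finset O → List (Finset I)) (n : ℕ) :
    Option (Option (Region.{u, v, w} I O)) :=
  (composeBuild A G ordY ordX n).map fun r => r.map Region.minimize

end Algorithm

end LTLfSynthesis

end

open LTLfSynthesis

noncomputable section

namespace LTLfSynthesis

open scoped Classical

variable {I : Type u} {O : Type v}

/-! Reachability games are determined: a state is agent-winning exactly if it lies in the attractor
`Win` of the accepting states (`mem_awin_iff`), so winning can be treated by induction. As the
product starts in a non-accepting state, realizability of the conjunction means that this state wins
in `G₁ × G₂` (`realizable_iff`). Replacing `G₁` by its region loses nothing: a win in the product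
projects to a win in `G₁`, so winning choices never leave `awin G₁`, and nothing is accepted from
`ew`. Only the languages of states matter here, so any `A` with the same minimization serves equally
well (`exists_bisim_of_minimize_iso`, `Bisim.win_inter_iff`).

The search preserves `Inv`: the marks are sound, every admissible choice at a seen inactive state is
refuted or fully explored, and every undetermined state reaches an active one. All active states
reach the state `s` of the current call. When the call ends and `s` is not a root, `s` reaches an
older active state, so undetermined states may wait. If `s` is a root, undetermined successors of
states in its component stay in that component, so the attractor computation there is complete
(`Finished.backwardSearch_lost`). When no call is active, every seen state is decided. Nested calls
discover new states, which bounds the recursion.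

The search continues after a first winning choice, so the winning states it finds are closed under
all safe choices. The region built from them therefore runs in lockstep with `awr (G₁ × G₂)` on
every word (`Corr.step`). This gives isomorphic minimizations, and an embedding when `A` is `awr G₁`
itself. -/

/-! ### Reachability games -/

/-- The attractor of the accepting states: the least set that contains them and every state from
which some agent choice leads into the set whatever the environment does. -/
inductive Win {S : Type w} (G : DFA (Finset (I ⊕ O)) S) : S → Prop
  | accept {s : S} : s ∈ G.accept → Win G s
  | choose {s : S} (Y : Finset O) : (∀ X, Win G (G.step s (letter X Y))) → Win G s

theorem history_succ (lam : ℕ → Finset I) (k : ℕ) :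
    history lam (k + 1) = lam 0 :: history (fun i => lam (i + 1)) k := by
  simp [history, List.range_succ_eq_map, Function.comp_def]

theorem history_succ' (lam : ℕ → Finset I) (k : ℕ) :
    history lam (k + 1) = history lam k ++ [lam k] := by
  simp [history, List.range_succ]

theorem Win.mem_awin {S : Type w} {G : DFA (Finset (I ⊕ O)) S} {s : S} (h : Win G s) :
    s ∈ awin G := by
  induction h with
  | accept h => exact ⟨fun _ => ∅, fun ⟨τ, h0, _, he⟩ => he 0 (h0 ▸ h)⟩
  | @choose s Y _ ih =>
    choose g hg using ih
    -- Play `Y` first; after the answer `X`, follow the strategy that wins from that successor.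
    refine ⟨fun l => match l with
      | [] => Y
      | X :: l => g X l, fun ⟨τ, h0, ⟨lam, hlam⟩, he⟩ => ?_⟩
    refine hg (lam 0) ⟨fun i => τ (i + 1), ?_, ⟨fun i => lam (i + 1), fun i => ?_⟩,
      fun i => he (i + 1)⟩
    · simpa [history, h0] using hlam 0
    · simpa [history_succ] using hlam (i + 1)

/-- A play that stays outside of the attractor, against the strategy `g`; the environment choices
are recorded in the history. -/
def evadingPlay {S : Type w} (G : DFA (Finset (I ⊕ O)) S) (g : Strategy I O)
    (esc : S → Finset O → Finset I) (s : S) : ℕ → List (Finset I) × S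
  | 0 => ([], s)
  | k + 1 =>
    let p := evadingPlay G g esc s k
    (p.1 ++ [esc p.2 (g p.1)], G.step p.2 (letter (esc p.2 (g p.1)) (g p.1)))

/-- Outside the attractor every agent choice has an answer that stays outside, so each strategy
admits a play that never meets an accepting state. -/
theorem win_of_mem_awin {S : Type w} {G : DFA (Finset (I ⊕ O)) S} {s : S} (h : s ∈ awin G) :
    Win G s := by
  obtain ⟨g, hg⟩ := h
  by_contra hs
  -- The assumption `¬ Win G s` stands under the existential so that `choose` yields a total
  -- function; the instance `∅` recovers it.
  have hesc : ∀ (s : S) (Y : Finset O), ∃ X : Finset I,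
      ¬ Win G s → ¬ Win G (G.step s (letter X Y)) := by
    intro s Y
    by_contra! hc
    exact (hc ∅).1 (.choose Y fun X => (hc X).2)
  choose esc hesc using hesc
  set p := evadingPlay G g esc s with hp
  have hwin : ∀ k, ¬ Win G (p k).2 := by
    intro k
    induction k with
    | zero => exact hs
    | succ k ih => exact hesc _ _ ih
  -- The recorded history is the actual one, which makes the play consistent with `g`.
  have hhist : ∀ k, history (fun i => esc (p i).2 (g (p i).1)) k = (p k).1 := by
    intro k
    induction k with
    | zero => rfl
    | succ k ih => rw [history_succ', ih]; rfl
  refine hg ⟨fun k => (p k).2, rfl, ⟨fun i => esc (p i).2 (g (p i).1), fun i => ?_⟩,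
    fun i hi => hwin i (.accept hi)⟩
  rw [hhist]; rfl

theorem mem_awin_iff {S : Type w} {G : DFA (Finset (I ⊕ O)) S} {s : S} :
    s ∈ awin G ↔ Win G s :=
  ⟨win_of_mem_awin, Win.mem_awin⟩

/-! ### Realizability as a reachability game -/

theorem eval_trace_succ {S : Type w} (G : DFA (Finset (I ⊕ O)) S) (g : Strategy I O)
    (lam : ℕ → Finset I) (k : ℕ) :
    G.eval (trace g lam (k + 1)) =
      G.step (G.eval (trace g lam k)) (letter (lam (k + 1)) (g (history lam (k + 1)))) := by
  rw [trace, List.range_succ, List.map_append, List.map_singleton,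
    DFA.eval_append_singleton]
  rfl

theorem eval_trace_zero {S : Type w} (G : DFA (Finset (I ⊕ O)) S) (g : Strategy I O)
    (lam : ℕ → Finset I) :
    G.eval (trace g lam 0) = G.step G.start (letter (lam 0) (g (history lam 0))) := by
  simp [trace]

/-- State `k + 1` of a play is the one reached by the trace with index `k`. State `0` belongs to the
empty trace, which realizability does not count; `h0` makes it harmless. -/
theorem realizable_iff {S : Type w} {G : DFA (Finset (I ⊕ O)) S} {φ : LTLf (I ⊕ O)}
    (hG : Recognizes G φ) (h0 : G.start ∉ G.accept) : Realizable φ ↔ G.start ∈ awin G := by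
  refine exists_congr fun g => ?_
  have hsat : ∀ lam k, Sat (trace g lam k) φ ↔ G.eval (trace g lam k) ∈ G.accept := fun lam k => by
    rw [← hG _ (by simp [trace]), DFA.mem_accepts]
  constructor
  · rintro hg ⟨τ, hτ0, ⟨lam, hlam⟩, he⟩
    obtain ⟨k, hk⟩ := hg lam
    have hτ : ∀ k, τ (k + 1) = G.eval (trace g lam k) := by
      intro k
      induction k with
      | zero => rw [hlam, hτ0, eval_trace_zero]
      | succ k ih => rw [hlam, ih, eval_trace_succ]
    rw [hsat, ← hτ] at hk
    exact he _ hk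
  · intro hg lam
    by_contra! hc
    refine hg ⟨fun i => i.casesOn G.start fun k => G.eval (trace g lam k), rfl,
      ⟨lam, fun i => ?_⟩, fun i => ?_⟩
    · cases i with
      | zero => exact eval_trace_zero G g lam
      | succ i => exact eval_trace_succ G g lam i
    · cases i with
      | zero => exact h0
      | succ i => exact fun h => hc i ((hsat _ _).2 h)

theorem Recognizes.inter {S₁ S₂ : Type w} {G₁ : DFA (Finset (I ⊕ O)) S₁}
    {G₂ : DFA (Finset (I ⊕ O)) S₂} {ψ₁ ψ₂ : LTLf (I ⊕ O)} (h₁ : Recognizes G₁ ψ₁)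
    (h₂ : Recognizes G₂ ψ₂) : Recognizes (G₁.inter G₂) (LTLf.and ψ₁ ψ₂) := fun ρ hρ => by
  rw [DFA.accepts_inter, Language.mem_inf, h₁ ρ hρ, h₂ ρ hρ, Sat]

/-! ### Correctness of the search -/

namespace SearchState

variable {S : Type w}

/-- The discovered states. -/
def seen (st : SearchState S) : Set S := st.awinState ∪ st.ewinState ∪ st.undetermined

/-- `st'` comes from `st` by a part of the search that starts from `s`; of the states seen in `st`,
only those in `Z` may have got new edges. -/
structure Ext (Z : Set S) (s : S) (st st' : SearchState S) : Prop where
  seen : st.seen ⊆ st'.seen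
  awin : st.awinState ⊆ st'.awinState
  ewin : st.ewinState ⊆ st'.ewinState
  edges : st.edges ⊆ st'.edges
  old_edges : ∀ a b, a ∈ st.seen → a ∉ Z → (a, b) ∈ st'.edges → (a, b) ∈ st.edges
  disc : ∀ a ∈ st.seen, st'.disc a = st.disc a
  clock : st.clock ≤ st'.clock
  new_disc : ∀ a ∈ st'.seen, a ∉ st.seen → st.clock ≤ st'.disc a
  reach : ∀ a ∈ st'.seen, a ∉ st.seen → st'.Reach s a

theorem Reach.mono {st st' : SearchState S} (h : st.edges ⊆ st'.edges) {a b : S}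
    (hab : st.Reach a b) : st'.Reach a b :=
  Relation.ReflTransGen.mono (fun _ _ h' => h h') a b hab

theorem Ext.refl (Z : Set S) (s : S) (st : SearchState S) : Ext Z s st st where
  seen := subset_rfl
  awin := subset_rfl
  ewin := subset_rfl
  edges := subset_rfl
  old_edges _ _ _ _ h := h
  disc _ _ := rfl
  clock := le_rfl
  new_disc _ h h' := absurd h h'
  reach _ h h' := absurd h h'

theorem Ext.trans {Z : Set S} {s : S} {st₁ st₂ st₃ : SearchState S} (h : Ext Z s st₁ st₂)
    (h' : Ext Z s st₂ st₃) : Ext Z s st₁ st₃ where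
  seen := h.seen.trans h'.seen
  awin := h.awin.trans h'.awin
  ewin := h.ewin.trans h'.ewin
  edges := h.edges.trans h'.edges
  old_edges a b ha hZ hab := h.old_edges a b ha hZ (h'.old_edges a b (h.seen ha) hZ hab)
  disc a ha := (h'.disc a (h.seen ha)).trans (h.disc a ha)
  clock := h.clock.trans h'.clock
  new_disc a ha ha' := by
    by_cases h2 : a ∈ st₂.seen
    · rw [h'.disc a h2]; exact h.new_disc a h2 ha'
    · exact h.clock.trans (h'.new_disc a ha h2)
  reach a ha ha' := by
    by_cases h2 : a ∈ st₂.seen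
    · exact (h.reach a h2 ha').mono h'.edges
    · exact h'.reach a ha h2

/-- A part of the search that touches neither edges nor discovery times nor the seen states. -/
theorem Ext.of_seen_eq (Z : Set S) (s : S) {st st' : SearchState S} (hs : st'.seen = st.seen)
    (ha : st.awinState ⊆ st'.awinState) (he : st.ewinState ⊆ st'.ewinState)
    (hE : st'.edges = st.edges) (hd : st'.disc = st.disc) (hc : st'.clock = st.clock) :
    Ext Z s st st' where
  seen := hs.ge
  awin := ha
  ewin := he
  edges := hE.ge
  old_edges _ _ _ _ h := hE ▸ h
  disc a _ := congrFun hd a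
  clock := hc.ge
  new_disc _ h h' := absurd (hs ▸ h) h'
  reach _ h h' := absurd (hs ▸ h) h'

theorem Ext.ncard_compl_le [Finite S] {Z : Set S} {s : S} {st st' : SearchState S}
    (h : Ext Z s st st') : st'.seenᶜ.ncard ≤ st.seenᶜ.ncard :=
  Set.ncard_le_ncard (Set.compl_subset_compl.2 h.seen)

end SearchState

open SearchState

/-! ### The invariant and the two loops -/

section Search

variable (A : Region.{u, v, w} I O) {S₂ : Type w} (G : DFA (Finset (I ⊕ O)) S₂)

/-- Either some environment choice refutes the agent choice `Y`, or all its successors have been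
explored. -/
def Explored (st : SearchState (A.State × S₂)) (s : A.State × S₂) (Y : Finset O) : Prop :=
  (∃ X, succ A G s X Y ∈ st.ewinState) ∨
    ∀ X, succ A G s X Y ∈ st.seen ∧ (s, succ A G s X Y) ∈ st.edges

/-- The invariant of the search. `Γ` is the set of states whose calls are active, and `P` holds of
the reachable states of `A`. -/
structure Inv (P : A.State → Prop) (Γ : Set (A.State × S₂)) (st : SearchState (A.State × S₂)) :
    Prop where
  awin_sound : ∀ s ∈ st.awinState, Win (A.dfa.inter G) s
  ewin_sound : ∀ s ∈ st.ewinState, ¬ Win (A.dfa.inter G) s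
  accept : ∀ s ∈ st.seen, s ∈ (A.dfa.inter G).accept → s ∈ st.awinState
  explored : ∀ s ∈ st.seen, s ∉ Γ → ∀ Y, Y ∉ ewinAgentChoices A s.1 → Explored A G st s Y
  edge_seen : ∀ s t, (s, t) ∈ st.edges → s ∉ Γ → t ∈ st.seen
  seen_edge : ∀ s t, (s, t) ∈ st.edges → s ∈ st.seen
  undet : ∀ s ∈ st.undetermined, ∃ γ ∈ Γ, st.Reach s γ
  reachable : ∀ s ∈ st.seen, P s.1
  disc_lt : ∀ s ∈ st.seen, st.disc s < st.clock
  active : Γ ⊆ st.seen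

variable {A G}

theorem Explored.mono {st st' : SearchState (A.State × S₂)} {s : A.State × S₂} {Y : Finset O}
    (h : Explored A G st s Y) (he : st.ewinState ⊆ st'.ewinState) (hs : st.seen ⊆ st'.seen)
    (hE : st.edges ⊆ st'.edges) : Explored A G st' s Y :=
  h.imp (fun ⟨X, hX⟩ => ⟨X, he hX⟩) fun h X => ⟨hs (h X).1, hE (h X).2⟩

/-- What a call of the search from `s` achieves. -/
structure CallPost (P : A.State → Prop) (Γ : Set (A.State × S₂)) (s : A.State × S₂)
    (st st' : SearchState (A.State × S₂)) : Prop where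
  inv : Inv A G P Γ st'
  ext : Ext ∅ s st st'
  mem : s ∈ st'.seen

/-- What a recursive call must satisfy, as long as fewer than `n` states are unseen. -/
def CallSpec (A : Region.{u, v, w} I O) (G : DFA (Finset (I ⊕ O)) S₂) (P : A.State → Prop) (n : ℕ)
    (call : A.State × S₂ → SearchState (A.State × S₂) → Option (SearchState (A.State × S₂))) :
    Prop :=
  ∀ Γ s st, Inv A G P Γ st → P s.1 → (∀ γ ∈ Γ, st.Reach γ s) → st.seenᶜ.ncard < n →
    ∃ st', call s st = some st' ∧ CallPost (G := G) P Γ s st st'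

/-- The invariant of the two loops in the call from `s`. -/
structure LoopInv (A : Region.{u, v, w} I O) (G : DFA (Finset (I ⊕ O)) S₂) (P : A.State → Prop)
    (Γ : Set (A.State × S₂)) (s : A.State × S₂)
    (st : SearchState (A.State × S₂)) : Prop where
  inv : Inv A G P (insert s Γ) st
  gray : ∀ γ ∈ Γ, st.Reach γ s
  edge_seen : ∀ t, (s, t) ∈ st.edges → t ∈ st.seen

theorem LoopInv.mem {P : A.State → Prop} {Γ : Set (A.State × S₂)} {s : A.State × S₂}
    {st : SearchState (A.State × S₂)} (h : LoopInv A G P Γ s st) : s ∈ st.seen :=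
  h.inv.active (Set.mem_insert s Γ)

theorem mem_seen {S : Type w} {st : SearchState S} {s : S} :
    s ∈ st.seen ↔ s ∈ st.awinState ∨ s ∈ st.ewinState ∨ s ∈ st.undetermined := by
  rw [SearchState.seen, Set.mem_union, Set.mem_union, or_assoc]

theorem Inv.addEdge {P : A.State → Prop} {Γ : Set (A.State × S₂)} {s t : A.State × S₂}
    {st : SearchState (A.State × S₂)} (h : Inv A G P Γ st) (hs : s ∈ Γ) :
    Inv A G P Γ (st.addEdge s t) where
  awin_sound := h.awin_sound
  ewin_sound := h.ewin_sound
  accept := h.accept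
  explored a ha haΓ Y hY :=
    (h.explored a ha haΓ Y hY).mono subset_rfl subset_rfl (Set.subset_insert _ _)
  edge_seen a b hab ha := by
    rcases Set.mem_insert_iff.1 hab with hab | hab
    · cases hab; exact absurd hs ha
    · exact h.edge_seen a b hab ha
  seen_edge a b hab := by
    rcases Set.mem_insert_iff.1 hab with hab | hab
    · cases hab; exact h.active hs
    · exact h.seen_edge a b hab
  undet a ha := by
    obtain ⟨γ, hγ, hr⟩ := h.undet a ha
    exact ⟨γ, hγ, hr.mono (Set.subset_insert _ _)⟩
  reachable := h.reachable
  disc_lt := h.disc_lt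
  active := h.active

/-- The edge added before the call makes the successor reachable from all active states, as
`CallSpec` demands. It also gives the already seen `s` a new edge, hence the exception `{s}` in
`Ext`. -/
theorem loop_call {P : A.State → Prop}
    (hstep : ∀ a, P a → ∀ l, P (A.dfa.step a l)) {n : ℕ}
    {call : A.State × S₂ → SearchState (A.State × S₂) → Option (SearchState (A.State × S₂))}
    (hcall : CallSpec A G P n call) {Γ : Set (A.State × S₂)} {s : A.State × S₂}
    {st : SearchState (A.State × S₂)} (hL : LoopInv A G P Γ s st) (hn : st.seenᶜ.ncard < n)
    (X : Finset I) (Y : Finset O) :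
    ∃ st', call (succ A G s X Y) (st.addEdge s (succ A G s X Y)) = some st' ∧
      LoopInv A G P Γ s st' ∧ Ext {s} s st st' ∧ succ A G s X Y ∈ st'.seen ∧
      (s, succ A G s X Y) ∈ st'.edges := by
  set t := succ A G s X Y with ht
  have hsub : st.edges ⊆ (st.addEdge s t).edges := Set.subset_insert _ _
  have hst : (s, t) ∈ (st.addEdge s t).edges := Set.mem_insert _ _
  have hsr : (st.addEdge s t).Reach s t := .single hst
  obtain ⟨st', h1, h2⟩ := hcall (insert s Γ) t (st.addEdge s t)
    (hL.inv.addEdge (Set.mem_insert _ _)) (hstep _ (hL.inv.reachable s hL.mem) _)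
    (by
      intro γ hγ
      rcases Set.mem_insert_iff.1 hγ with rfl | hγ
      · exact hsr
      · exact ((hL.gray γ hγ).mono hsub).trans hsr) hn
  refine ⟨st', h1, ⟨h2.inv, fun γ hγ => (hL.gray γ hγ).mono (hsub.trans h2.ext.edges), ?_⟩, ?_,
    h2.mem, h2.ext.edges hst⟩
  · intro b hb
    rcases Set.mem_insert_iff.1
      (h2.ext.old_edges s b hL.mem (Set.notMem_empty _) hb) with hb | hb
    · cases hb; exact h2.mem
    · exact h2.ext.seen (hL.edge_seen b hb)
  · exact
      { seen := h2.ext.seen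
        awin := h2.ext.awin
        ewin := h2.ext.ewin
        edges := hsub.trans h2.ext.edges
        old_edges := fun a b ha has hab => by
          rcases Set.mem_insert_iff.1
            (h2.ext.old_edges a b ha (Set.notMem_empty _) hab) with hb | hb
          · cases hb; exact absurd rfl has
          · exact hb
        disc := h2.ext.disc
        clock := h2.ext.clock
        new_disc := h2.ext.new_disc
        reach := fun a ha ha' => (hsr.mono h2.ext.edges).trans (h2.ext.reach a ha ha') }

/-- The sets `awin` and `ewin` only grow, so what they showed right after a call still holds when
the loop ends. Undetermined states may be decided later, and nothing is claimed about them. -/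
theorem loopX_spec [Finite A.State] [Finite S₂] {P : A.State → Prop} (hstep : ∀ a, P a → ∀ l, P (A.dfa.step a l)) {n : ℕ}
    {call : A.State × S₂ → SearchState (A.State × S₂) → Option (SearchState (A.State × S₂))}
    (hcall : CallSpec A G P n call) {Γ : Set (A.State × S₂)} {s : A.State × S₂} (Y : Finset O)
    (Xs : List (Finset I)) :
    ∀ (st : SearchState (A.State × S₂)) (und : Bool), LoopInv A G P Γ s st →
      st.seenᶜ.ncard < n →
      ∃ st' b und', loopX A G call s Y Xs st und = some (st', b, und') ∧
        LoopInv A G P Γ s st' ∧ Ext {s} s st st' ∧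
        (b = true → ∃ X, succ A G s X Y ∈ st'.ewinState) ∧
        (b = false → ∀ X ∈ Xs, succ A G s X Y ∈ st'.seen ∧ (s, succ A G s X Y) ∈ st'.edges) ∧
        (b = false → und' = false →
          und = false ∧ ∀ X ∈ Xs, succ A G s X Y ∈ st'.awinState) := by
  induction Xs with
  | nil => exact fun st und hL _ => ⟨st, false, und, rfl, hL, .refl _ _ _, by simp, by simp, by simp⟩
  | cons X Xs ih =>
    intro st und hL hn
    obtain ⟨st₁, h1, hL₁, hE₁, hseen, hedge⟩ := loop_call hstep hcall hL hn X Y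
    rw [loopX, h1, Option.bind_some]
    by_cases hew : succ A G s X Y ∈ st₁.ewinState
    · rw [if_pos hew]
      exact ⟨st₁, true, und, rfl, hL₁, hE₁, fun _ => ⟨X, hew⟩, by simp, by simp⟩
    rw [if_neg hew]
    have hn₁ := hE₁.ncard_compl_le.trans_lt hn
    by_cases hun : succ A G s X Y ∈ st₁.undetermined
    · rw [if_pos hun]
      obtain ⟨st', b, und', h2, hL', hE', hb, hb', hu⟩ := ih st₁ true hL₁ hn₁
      refine ⟨st', b, und', h2, hL', hE₁.trans hE', hb, fun hbf => ?_, fun hbf huf => ?_⟩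
      · exact List.forall_mem_cons.2 ⟨⟨hE'.seen hseen, hE'.edges hedge⟩, hb' hbf⟩
      · exact absurd (hu hbf huf).1 (by simp)
    · rw [if_neg hun]
      obtain ⟨st', b, und', h2, hL', hE', hb, hb', hu⟩ := ih st₁ und hL₁ hn₁
      refine ⟨st', b, und', h2, hL', hE₁.trans hE', hb, fun hbf => ?_, fun hbf huf => ?_⟩
      · exact List.forall_mem_cons.2 ⟨⟨hE'.seen hseen, hE'.edges hedge⟩, hb' hbf⟩
      · refine ⟨(hu hbf huf).1, List.forall_mem_cons.2 ⟨hE'.awin ?_, (hu hbf huf).2⟩⟩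
        -- Seen, but neither in `ewin` nor undetermined: only `awin` is left.
        have := mem_seen.1 hseen
        tauto

theorem seen_moveAwin {S : Type w} {st : SearchState S} {s : S} (hs : s ∈ st.seen) :
    ((st.removeUndetermined s).insertAwin s).seen = st.seen := by
  ext t
  rw [mem_seen] at hs
  simp only [mem_seen, removeUndetermined, insertAwin, Set.mem_insert_iff, Set.mem_sdiff,
    Set.mem_singleton_iff]
  by_cases h : t = s
  · subst h; simp [hs]
  · simp [h]

theorem seen_moveEwin {S : Type w} {st : SearchState S} {s : S} (hs : s ∈ st.seen) :
    ((st.removeUndetermined s).insertEwin s).seen = st.seen := by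
  ext t
  rw [mem_seen] at hs
  simp only [mem_seen, removeUndetermined, insertEwin, Set.mem_insert_iff, Set.mem_sdiff,
    Set.mem_singleton_iff]
  by_cases h : t = s
  · subst h; simp [hs]
  · simp [h]

/-- The invariant survives sound changes of the sets `awin` and `ewin`. -/
theorem Inv.of_seen_eq {P : A.State → Prop} {Γ : Set (A.State × S₂)}
    {st st' : SearchState (A.State × S₂)} (h : Inv A G P Γ st) (hs : st'.seen = st.seen)
    (ha : st.awinState ⊆ st'.awinState) (he : st.ewinState ⊆ st'.ewinState)
    (hu : st'.undetermined ⊆ st.undetermined)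
    (hE : st'.edges = st.edges) (hd : st'.disc = st.disc) (hc : st'.clock = st.clock)
    (hwa : ∀ s ∈ st'.awinState, Win (A.dfa.inter G) s)
    (hwe : ∀ s ∈ st'.ewinState, ¬ Win (A.dfa.inter G) s) : Inv A G P Γ st' where
  awin_sound := hwa
  ewin_sound := hwe
  accept a has hacc := ha (h.accept a (hs ▸ has) hacc)
  explored a has haΓ Y hY := (h.explored a (hs ▸ has) haΓ Y hY).mono he hs.ge hE.ge
  edge_seen a b hab haΓ := hs ▸ h.edge_seen a b (hE ▸ hab) haΓ
  seen_edge a b hab := hs ▸ h.seen_edge a b (hE ▸ hab)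
  undet a hau := by
    obtain ⟨γ, hγ, hr⟩ := h.undet a (hu hau)
    exact ⟨γ, hγ, hr.mono hE.ge⟩
  reachable a has := h.reachable a (hs ▸ has)
  disc_lt a has := by rw [hd, hc]; exact h.disc_lt a (hs ▸ has)
  active := hs ▸ h.active

theorem LoopInv.of_inv {P : A.State → Prop} {Γ : Set (A.State × S₂)} {s : A.State × S₂}
    {st st' : SearchState (A.State × S₂)} (h : LoopInv A G P Γ s st)
    (h' : Inv A G P (insert s Γ) st') (hs : st'.seen = st.seen) (hE : st'.edges = st.edges) :
    LoopInv A G P Γ s st' where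
  inv := h'
  gray γ hγ := (h.gray γ hγ).mono hE.ge
  edge_seen t ht := hs ▸ h.edge_seen t (hE ▸ ht)

/-- The loop does not stop at a winning choice, so the last clause covers all of `Ys`; closedness of
the winning set under safe choices rests on this. Once cleared, the flag stays cleared, which makes
its clause vacuous in those cases. -/
theorem loopY_spec [Finite A.State] [Finite S₂] {P : A.State → Prop} (hstep : ∀ a, P a → ∀ l, P (A.dfa.step a l)) {n : ℕ}
    {call : A.State × S₂ → SearchState (A.State × S₂) → Option (SearchState (A.State × S₂))}
    (hcall : CallSpec A G P n call) {ordX : A.State × S₂ → Finset O → List (Finset I)}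
    (hordX : ∀ s Y X, X ∈ ordX s Y) {Γ : Set (A.State × S₂)} {s : A.State × S₂}
    (Ys : List (Finset O)) :
    ∀ (st : SearchState (A.State × S₂)) (e : Bool), LoopInv A G P Γ s st →
      st.seenᶜ.ncard < n →
      ∃ st' e', loopY A G call ordX s Ys st e = some (st', e') ∧
        LoopInv A G P Γ s st' ∧ Ext {s} s st st' ∧
        (e' = true → ∀ Y ∈ Ys, ∃ X, succ A G s X Y ∈ st'.ewinState) ∧
        (e = false → e' = false) ∧
        (∀ Y ∈ Ys, Explored A G st' s Y) := by
  induction Ys with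
  | nil => exact fun st e hL _ => ⟨st, e, rfl, hL, .refl _ _ _, by simp, id, by simp⟩
  | cons Y Ys ih =>
    intro st e hL hn
    obtain ⟨st₁, b, und, h1, hL₁, hE₁, hb, hb', hu⟩ :=
      loopX_spec hstep hcall Y (ordX s Y) st false hL hn
    rw [loopY, h1, Option.bind_some]
    have hn₁ := hE₁.ncard_compl_le.trans_lt hn
    cases b with
    | true =>
      obtain ⟨X, hX⟩ := hb rfl
      obtain ⟨st', e', h2, hL', hE', he, he', hY⟩ := ih st₁ e hL₁ hn₁
      refine ⟨st', e', h2, hL', hE₁.trans hE', fun h => ?_, he', ?_⟩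
      · exact List.forall_mem_cons.2 ⟨⟨X, hE'.ewin hX⟩, he h⟩
      · exact List.forall_mem_cons.2 ⟨.inl ⟨X, hE'.ewin hX⟩, hY⟩
    | false =>
      have hex : Explored A G st₁ s Y := .inr fun X => hb' rfl X (hordX s Y X)
      cases und with
      | true =>
        obtain ⟨st', e', h2, hL', hE', he, he', hY⟩ := ih st₁ false hL₁ hn₁
        refine ⟨st', e', h2, hL', hE₁.trans hE', fun h => ?_, fun _ => he' rfl, ?_⟩
        · exact absurd (he' rfl) (by simp [h])
        · exact List.forall_mem_cons.2 ⟨hex.mono hE'.ewin hE'.seen hE'.edges, hY⟩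
      | false =>
        -- Neither flag was raised, so every successor under `Y` is known to be winning.
        have hwin : Win (A.dfa.inter G) s :=
          .choose Y fun X => hL₁.inv.awin_sound _ ((hu rfl rfl).2 X (hordX s Y X))
        have hs := seen_moveAwin hL₁.mem
        have hE₂ : Ext {s} s st₁ ((st₁.removeUndetermined s).insertAwin s) :=
          .of_seen_eq _ _ hs (Set.subset_insert _ _) subset_rfl rfl rfl rfl
        have hL₂ : LoopInv A G P Γ s ((st₁.removeUndetermined s).insertAwin s) :=
          hL₁.of_inv (hL₁.inv.of_seen_eq hs (Set.subset_insert _ _) subset_rfl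
            Set.sdiff_subset rfl rfl rfl
            (fun t ht => by
              rcases Set.mem_insert_iff.1 ht with rfl | ht
              · exact hwin
              · exact hL₁.inv.awin_sound t ht) hL₁.inv.ewin_sound) hs rfl
        obtain ⟨st', e', h2, hL', hE', he, he', hY⟩ :=
          ih _ false hL₂ (hE₂.ncard_compl_le.trans_lt hn₁)
        have hE'' := hE₂.trans hE'
        refine ⟨st', e', h2, hL', hE₁.trans hE'', fun h => ?_, fun _ => he' rfl, ?_⟩
        · exact absurd (he' rfl) (by simp [h])
        · exact List.forall_mem_cons.2 ⟨hex.mono hE''.ewin hE''.seen hE''.edges, hY⟩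

end Search

theorem discover_disc_self {S : Type w} (st : SearchState S) (s : S) :
    (st.discover s).disc s = st.clock := by
  simp only [discover, Function.update_self]

theorem discover_disc_of_ne {S : Type w} (st : SearchState S) {s t : S} (h : t ≠ s) :
    (st.discover s).disc t = st.disc t := by
  simp only [discover, Function.update_of_ne h]

/-! ### Leaving a call: roots of components -/

section Search

variable {A : Region.{u, v, w} I O} {S₂ : Type w} {G : DFA (Finset (I ⊕ O)) S₂}

/-- The situation when both loops of the call from `s`, which began in `st`, are over. -/
structure Finished (A : Region.{u, v, w} I O) (G : DFA (Finset (I ⊕ O)) S₂) (P : A.State → Prop)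
    (Γ : Set (A.State × S₂)) (s : A.State × S₂) (st st' : SearchState (A.State × S₂)) : Prop where
  start : Inv A G P Γ st
  fresh : s ∉ st.seen
  loop : LoopInv A G P Γ s st'
  ext : Ext ∅ s st st'
  disc : st'.disc s = st.clock
  explored : ∀ Y, Y ∉ ewinAgentChoices A s.1 → Explored A G st' s Y

variable {P : A.State → Prop} {Γ : Set (A.State × S₂)} {s : A.State × S₂}
  {st st' : SearchState (A.State × S₂)}

/-- Inactive states seen before the call have edges to seen states only, and the call adds none to
them. A path from the old part to the fresh `s` must therefore pass through an active state. -/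
theorem Finished.escape (h : Finished A G P Γ s st st') {a : A.State × S₂} (ha : a ∈ st.seen)
    (has : st'.Reach a s) : ∃ γ ∈ Γ, st'.Reach a γ := by
  induction has using Relation.ReflTransGen.head_induction_on with
  | refl => exact absurd ha h.fresh
  | @head a b hab _ ih =>
    by_cases haΓ : a ∈ Γ
    · exact ⟨a, haΓ, .refl⟩
    · obtain ⟨γ, hγ, hr⟩ :=
        ih (h.start.edge_seen a b (h.ext.old_edges a b ha (Set.notMem_empty _) hab) haΓ)
      exact ⟨γ, hγ, .head hab hr⟩

/-- Only older active states can still have edges to unseen states; `s` has none once its loops are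
over. -/
theorem Finished.reach_seen (h : Finished A G P Γ s st st') {t : A.State × S₂}
    (hst : st'.Reach s t) : t ∈ st'.seen ∨ ∃ γ ∈ Γ, st'.Reach s γ := by
  induction hst with
  | refl => exact .inl h.loop.mem
  | @tail b c hb hbc ih =>
    refine ih.elim (fun hbs => ?_) .inr
    by_cases hbΓ : b ∈ Γ
    · exact .inr ⟨b, hbΓ, hb⟩
    by_cases hbs' : b = s
    · subst hbs'; exact .inl (h.loop.edge_seen c hbc)
    · exact .inl (h.loop.inv.edge_seen b c hbc (by simp [hbΓ, hbs']))

/-- If `s` reached no older active state, its component would consist of states discovered during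
this call, none of them before `s`, and `s` would be its root. -/
theorem Finished.exists_reach_of_not_root (h : Finished A G P Γ s st st')
    (hr : ¬ st'.IsSccRoot s) : ∃ γ ∈ Γ, st'.Reach s γ := by
  by_contra hc
  refine hr fun t ⟨hst, hts⟩ => ?_
  rw [h.disc]
  refine h.ext.new_disc t ((h.reach_seen hst).resolve_right hc) fun ht => hc ?_
  obtain ⟨γ, hγ, hr⟩ := h.escape ht hts
  exact ⟨γ, hγ, hst.trans hr⟩

theorem Finished.explored' (h : Finished A G P Γ s st st') (t : A.State × S₂) (ht : t ∈ st'.seen)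
    (htΓ : t ∉ Γ) (Y : Finset O) (hY : Y ∉ ewinAgentChoices A t.1) : Explored A G st' t Y := by
  by_cases hts : t = s
  · subst hts; exact h.explored Y hY
  · exact h.loop.inv.explored t ht (by simp [htΓ, hts]) Y hY

theorem Finished.edge_seen (h : Finished A G P Γ s st st') (a b : A.State × S₂)
    (hab : (a, b) ∈ st'.edges) (ha : a ∉ Γ) : b ∈ st'.seen := by
  by_cases has : a = s
  · subst has; exact h.loop.edge_seen b hab
  · exact h.loop.inv.edge_seen a b hab (by simp [ha, has])

/-- Leaving the call from `s` shrinks the set of active states. -/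
theorem Finished.inv (h : Finished A G P Γ s st st') {st'' : SearchState (A.State × S₂)}
    (h' : Inv A G P (insert s Γ) st'') (hs : st''.seen = st'.seen) (hE : st''.edges = st'.edges)
    (he : st'.ewinState ⊆ st''.ewinState)
    (hu : ∀ t ∈ st''.undetermined, ∃ γ ∈ Γ, st'.Reach t γ) : Inv A G P Γ st'' where
  awin_sound := h'.awin_sound
  ewin_sound := h'.ewin_sound
  accept := h'.accept
  explored t ht htΓ Y hY := (h.explored' t (hs ▸ ht) htΓ Y hY).mono he hs.ge hE.ge
  edge_seen a b hab ha := hs ▸ h.edge_seen a b (hE ▸ hab) ha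
  seen_edge := h'.seen_edge
  undet t ht := by
    obtain ⟨γ, hγ, hr⟩ := hu t ht
    exact ⟨γ, hγ, hr.mono hE.ge⟩
  reachable := h'.reachable
  disc_lt := h'.disc_lt
  active := (Set.subset_insert _ _).trans h'.active

theorem Finished.inv_of_not_root (h : Finished A G P Γ s st st') (hr : ¬ st'.IsSccRoot s) :
    Inv A G P Γ st' := by
  refine h.inv h.loop.inv rfl rfl subset_rfl fun t ht => ?_
  obtain ⟨γ, hγ, htγ⟩ := h.loop.inv.undet t ht
  rcases Set.mem_insert_iff.1 hγ with rfl | hγ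
  · obtain ⟨γ', hγ', hr'⟩ := h.exists_reach_of_not_root hr
    exact ⟨γ', hγ', htγ.trans hr'⟩
  · exact ⟨γ, hγ, htγ⟩

/-! ### Backward search in a component -/

section Backward

variable (A G)

theorem backwardStep_iterate_mono (U W : Set (A.State × S₂)) :
    Monotone fun n => (backwardStep A G U)^[n] W :=
  monotone_nat_of_le_succ fun n => by
    rw [Function.iterate_succ_apply']
    exact Set.subset_union_left

variable {A G}

theorem backwardStep_iterate_win {U W : Set (A.State × S₂)}
    (hW : ∀ t ∈ W, Win (A.dfa.inter G) t) (n : ℕ) :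
    ∀ t ∈ (backwardStep A G U)^[n] W, Win (A.dfa.inter G) t := by
  induction n with
  | zero => exact hW
  | succ n ih =>
    intro t ht
    rw [Function.iterate_succ_apply'] at ht
    rcases ht with ht | ⟨_, Y, _, hY⟩
    · exact ih t ht
    · exact .choose Y fun X => ih _ (hY X)

theorem backwardStep_iterate_subset {U W : Set (A.State × S₂)} (n : ℕ) :
    (backwardStep A G U)^[n] W ⊆ W ∪ U := by
  induction n with
  | zero => exact Set.subset_union_left
  | succ n ih =>
    rw [Function.iterate_succ_apply']
    exact Set.union_subset ih fun t ht => .inr ht.1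

/-- There are finitely many environment choices, so all successors are present at a common stage of
the increasing union. -/
theorem mem_iUnion_backwardStep [Finite I] {U W : Set (A.State × S₂)} {t : A.State × S₂}
    (ht : t ∈ U) {Y : Finset O} (hY : Y ∉ ewinAgentChoices A t.1)
    (h : ∀ X, succ A G t X Y ∈ ⋃ n, (backwardStep A G U)^[n] W) :
    t ∈ ⋃ n, (backwardStep A G U)^[n] W := by
  have := Fintype.ofFinite (Finset I)
  choose f hf using fun X => Set.mem_iUnion.1 (h X)
  refine Set.mem_iUnion.2 ⟨Finset.univ.sup f + 1, ?_⟩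
  rw [Function.iterate_succ_apply']
  exact .inr ⟨ht, Y, hY, fun X =>
    backwardStep_iterate_mono A G U W (Finset.le_sup (Finset.mem_univ X)) (hf X)⟩

end Backward

/-- Older active states were discovered before `s`, which a root forbids within its component. -/
theorem Finished.not_mem_active_of_mem_scc (h : Finished A G P Γ s st st')
    (hr : st'.IsSccRoot s) {t : A.State × S₂} (ht : t ∈ st'.scc s) : t ∉ Γ := fun htΓ => by
  have h0 := h.start.active htΓ
  have h1 := hr t ht
  rw [h.disc, h.ext.disc t h0] at h1
  exact absurd (h.start.disc_lt t h0) (not_lt.2 h1)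

/-- Induction on the attractor. A winning choice is neither excluded nor refuted, so its successors
are in `awin` or undetermined. An undetermined one reaches an active state and thereby `s`; hence it
lies in the component and the induction hypothesis applies. -/
theorem Finished.backwardSearch_lost [Finite I] (h : Finished A G P Γ s st st')
    (hew : ∀ t : A.State × S₂, P t.1 → t.1 ∈ A.ew → ¬ Win (A.dfa.inter G) t)
    (hstep : ∀ a, P a → ∀ l, P (A.dfa.step a l))
    (hr : st'.IsSccRoot s) {t : A.State × S₂} (hw : Win (A.dfa.inter G) t)
    (ht : t ∈ st'.scc s ∩ st'.undetermined) :
    t ∈ ⋃ n, (backwardStep A G (st'.scc s ∩ st'.undetermined))^[n] st'.awinState := by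
  have hsub : st'.awinState ⊆
      ⋃ n, (backwardStep A G (st'.scc s ∩ st'.undetermined))^[n] st'.awinState :=
    fun a ha => Set.mem_iUnion.2 ⟨0, ha⟩
  induction hw with
  | @accept t hacc =>
    exact hsub (h.loop.inv.accept t (mem_seen.2 (.inr (.inr ht.2))) hacc)
  | @choose t Y hY ih =>
    have hts : t ∈ st'.seen := mem_seen.2 (.inr (.inr ht.2))
    have hPt := h.loop.inv.reachable t hts
    have hYe : Y ∉ ewinAgentChoices A t.1 := fun ⟨X, hX⟩ =>
      hew (succ A G t X Y) (hstep _ hPt _) hX (hY X)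
    rcases h.explored' t hts (h.not_mem_active_of_mem_scc hr ht.1) Y hYe with ⟨X, hX⟩ | hall
    · exact absurd (hY X) (h.loop.inv.ewin_sound _ hX)
    refine mem_iUnion_backwardStep ht hYe fun X => ?_
    obtain ⟨hseen, hedge⟩ := hall X
    rcases mem_seen.1 hseen with hX | hX | hX
    · exact hsub hX
    · exact absurd (hY X) (h.loop.inv.ewin_sound _ hX)
    · refine ih X ⟨⟨ht.1.1.tail hedge, ?_⟩, hX⟩
      obtain ⟨γ, hγ, hXγ⟩ := h.loop.inv.undet _ hX
      rcases Set.mem_insert_iff.1 hγ with rfl | hγ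
      · exact hXγ
      · exact hXγ.trans (h.loop.gray γ hγ)

theorem seen_backwardSearch (C : Set (A.State × S₂)) (st : SearchState (A.State × S₂)) :
    (backwardSearch A G C st).seen = st.seen := by
  ext t
  have h0 : t ∈ st.awinState → t ∈ ⋃ n, (backwardStep A G (C ∩ st.undetermined))^[n] st.awinState :=
    fun ha => Set.mem_iUnion.2 ⟨0, ha⟩
  have h1 : t ∈ ⋃ n, (backwardStep A G (C ∩ st.undetermined))^[n] st.awinState →
      t ∈ st.awinState ∪ C ∩ st.undetermined := fun ha => by
    obtain ⟨n, hn⟩ := Set.mem_iUnion.1 ha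
    exact backwardStep_iterate_subset n hn
  simp only [mem_seen, backwardSearch, Set.mem_union, Set.mem_sdiff]
  simp only [Set.mem_union, Set.mem_inter_iff] at h1 ⊢
  tauto

theorem Finished.inv_backwardSearch [Finite I] (h : Finished A G P Γ s st st')
    (hew : ∀ t : A.State × S₂, P t.1 → t.1 ∈ A.ew → ¬ Win (A.dfa.inter G) t)
    (hstep : ∀ a, P a → ∀ l, P (A.dfa.step a l)) (hr : st'.IsSccRoot s) :
    Inv A G P Γ (backwardSearch A G (st'.scc s) st') := by
  have hseen := seen_backwardSearch (G := G) (st'.scc s) st'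
  refine h.inv (h.loop.inv.of_seen_eq hseen (fun a ha => Set.mem_iUnion.2 ⟨0, ha⟩)
    Set.subset_union_left Set.sdiff_subset rfl rfl rfl ?_ ?_) hseen rfl Set.subset_union_left ?_
  · intro t ht
    obtain ⟨n, hn⟩ := Set.mem_iUnion.1 ht
    exact backwardStep_iterate_win h.loop.inv.awin_sound n t hn
  · rintro t (ht | ⟨htU, htW⟩) hw
    · exact h.loop.inv.ewin_sound t ht hw
    · exact htW (h.backwardSearch_lost hew hstep hr hw htU)
  · rintro t ⟨htu, htU⟩
    obtain ⟨γ, hγ, htγ⟩ := h.loop.inv.undet t htu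
    rcases Set.mem_insert_iff.1 hγ with rfl | hγ
    -- Here `t` reaches `s`. Had this call discovered `t`, then `t` would lie in the component and
    -- have been removed; so `t` is old.
    · refine h.escape ?_ htγ
      by_contra h0
      exact htU ⟨⟨h.ext.reach t (mem_seen.2 (.inr (.inr htu))) h0, htγ⟩, htu⟩
    · exact ⟨γ, hγ, htγ⟩

theorem Finished.callPost [Finite I] (h : Finished A G P Γ s st st')
    (hew : ∀ t : A.State × S₂, P t.1 → t.1 ∈ A.ew → ¬ Win (A.dfa.inter G) t)
    (hstep : ∀ a, P a → ∀ l, P (A.dfa.step a l)) :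
    CallPost (G := G) P Γ s st
      (if st'.IsSccRoot s then backwardSearch A G (st'.scc s) st' else st') := by
  split_ifs with hr
  · have hseen := seen_backwardSearch (G := G) (st'.scc s) st'
    exact ⟨h.inv_backwardSearch hew hstep hr, h.ext.trans (.of_seen_eq _ _ hseen
      (fun a ha => Set.mem_iUnion.2 ⟨0, ha⟩) Set.subset_union_left rfl rfl rfl),
      hseen ▸ h.loop.mem⟩
  · exact ⟨h.inv_of_not_root hr, h.ext, h.loop.mem⟩

/-- The search state at the beginning of the loops in the call from `s`. -/
def enter (A : Region.{u, v, w} I O) (G : DFA (Finset (I ⊕ O)) S₂) (s : A.State × S₂)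
    (st : SearchState (A.State × S₂)) : SearchState (A.State × S₂) :=
  (if s.1 ∈ A.dfa.accept ∧ s.2 ∈ G.accept then (st.discover s).insertAwin s
    else st.discover s).insertUndetermined s

theorem enter_edges : (enter A G s st).edges = st.edges := by
  rw [enter]; split_ifs <;> rfl

theorem enter_disc : (enter A G s st).disc = (st.discover s).disc := by
  rw [enter]; split_ifs <;> rfl

theorem enter_clock : (enter A G s st).clock = st.clock + 1 := by
  rw [enter]; split_ifs <;> rfl

theorem enter_ewin : (enter A G s st).ewinState = st.ewinState := by
  rw [enter]; split_ifs <;> rfl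

theorem enter_undetermined : (enter A G s st).undetermined = insert s st.undetermined := by
  rw [enter]; split_ifs <;> rfl

theorem mem_enter_awin {t : A.State × S₂} : t ∈ (enter A G s st).awinState ↔
    t ∈ st.awinState ∨ t = s ∧ s ∈ (A.dfa.inter G).accept := by
  rw [enter, DFA.inter_accept]
  split_ifs with h
  · exact ⟨fun ht => ht.elim (fun h' => .inr ⟨h', h⟩) .inl,
      fun ht => ht.elim .inr fun h' => .inl h'.1⟩
  · exact ⟨.inl, fun ht => ht.elim id fun h' => absurd h'.2 h⟩

theorem enter_seen : (enter A G s st).seen = insert s st.seen := by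
  ext t
  rw [mem_seen, Set.mem_insert_iff, mem_seen, mem_enter_awin, enter_ewin, enter_undetermined,
    Set.mem_insert_iff]
  tauto

theorem ext_enter (hs : s ∉ st.seen) (Z : Set (A.State × S₂)) : Ext Z s st (enter A G s st) where
  seen := enter_seen.ge.trans' (Set.subset_insert _ _)
  awin _ ha := mem_enter_awin.2 (.inl ha)
  ewin := enter_ewin.ge
  edges := enter_edges.ge
  old_edges _ _ _ _ h := enter_edges.le h
  disc a ha := by
    rw [enter_disc, discover_disc_of_ne]
    rintro rfl
    exact hs ha
  clock := by rw [enter_clock]; exact Nat.le_succ _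
  new_disc a ha ha' := by
    rw [enter_seen] at ha
    obtain rfl := ha.resolve_right ha'
    rw [enter_disc, discover_disc_self]
  reach a ha ha' := by
    rw [enter_seen] at ha
    obtain rfl := ha.resolve_right ha'
    exact .refl

theorem Inv.loopInv_enter (h : Inv A G P Γ st) (hs : s ∉ st.seen) (hP : P s.1)
    (hΓ : ∀ γ ∈ Γ, st.Reach γ s) : LoopInv A G P Γ s (enter A G s st) where
  inv :=
    { awin_sound := fun t ht => by
        rcases mem_enter_awin.1 ht with ht | ⟨rfl, hacc⟩
        · exact h.awin_sound t ht
        · exact .accept hacc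
      ewin_sound := fun t ht => h.ewin_sound t (enter_ewin.le ht)
      accept := fun t ht hacc => by
        rw [enter_seen] at ht
        rcases ht with rfl | ht
        · exact mem_enter_awin.2 (.inr ⟨rfl, hacc⟩)
        · exact mem_enter_awin.2 (.inl (h.accept t ht hacc))
      explored := fun t ht htΓ Y hY => by
        rw [enter_seen] at ht
        have ht := ht.resolve_left fun e => htΓ (.inl e)
        have hE := ext_enter (G := G) hs ∅
        exact (h.explored t ht (fun e => htΓ (.inr e)) Y hY).mono hE.ewin hE.seen hE.edges
      edge_seen := fun a b hab ha => (ext_enter hs ∅).seen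
        (h.edge_seen a b (enter_edges.le hab) fun e => ha (.inr e))
      seen_edge := fun a b hab => (ext_enter hs ∅).seen (h.seen_edge a b (enter_edges.le hab))
      undet := fun t ht => by
        rw [enter_undetermined] at ht
        rcases ht with rfl | ht
        · exact ⟨t, .inl rfl, .refl⟩
        · obtain ⟨γ, hγ, hr⟩ := h.undet t ht
          exact ⟨γ, .inr hγ, hr.mono enter_edges.ge⟩
      reachable := fun t ht => by
        rw [enter_seen] at ht
        rcases ht with rfl | ht
        · exact hP
        · exact h.reachable t ht
      disc_lt := fun t ht => by
        rw [enter_seen] at ht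
        rw [enter_clock, enter_disc]
        by_cases hts : t = s
        · subst hts; rw [discover_disc_self]; exact Nat.lt_succ_self _
        · rw [discover_disc_of_ne _ hts]
          exact (h.disc_lt t (ht.resolve_left hts)).trans (Nat.lt_succ_self _)
      active := enter_seen.ge.trans' (Set.insert_subset_insert h.active) }
  gray γ hγ := (hΓ γ hγ).mono enter_edges.ge
  edge_seen t ht := absurd (h.seen_edge s t (enter_edges.le ht)) hs

/-- Induction on the recursion bound: entering a fresh state lowers the number of unseen states,
which leaves room for the nested calls. -/
theorem dfSearch_spec [Finite I] [Finite A.State] [Finite S₂]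
    (hew : ∀ t : A.State × S₂, P t.1 → t.1 ∈ A.ew → ¬ Win (A.dfa.inter G) t)
    (hstep : ∀ a, P a → ∀ l, P (A.dfa.step a l))
    {ordY : A.State × S₂ → List (Finset O)} (hordY : ∀ s Y, Y ∈ ordY s)
    {ordX : A.State × S₂ → Finset O → List (Finset I)} (hordX : ∀ s Y X, X ∈ ordX s Y) (n : ℕ) :
    CallSpec A G P n (dfSearch A G ordY ordX n) := by
  induction n with
  | zero => exact fun _ _ _ _ _ _ h => absurd h (Nat.not_lt_zero _)
  | succ n ih =>
    intro Γ s st hI hP hΓ hn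
    rw [dfSearch]
    by_cases hs : s ∈ st.awinState ∪ st.ewinState ∪ st.undetermined
    · rw [if_pos hs]
      exact ⟨st, rfl, hI, .refl _ _ _, hs⟩
    rw [if_neg hs]
    have hn' : (enter A G s st).seenᶜ.ncard < n := by
      refine lt_of_lt_of_le (Set.ncard_lt_ncard ?_) (Nat.lt_succ_iff.1 hn)
      rw [enter_seen]
      exact compl_lt_compl_iff_lt.2 (Set.ssubset_insert hs)
    obtain ⟨st₃, e, h1, hL, hE, he, -, hex⟩ := loopY_spec hstep ih hordX
      ((ordY s).filter fun Y => Y ∉ ewinAgentChoices A s.1) _ true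
      (hI.loopInv_enter hs hP hΓ) hn'
    have hfil : ∀ Y, Y ∉ ewinAgentChoices A s.1 →
        Y ∈ (ordY s).filter fun Y => Y ∉ ewinAgentChoices A s.1 := fun Y hY =>
      List.mem_filter.2 ⟨hordY s Y, decide_eq_true hY⟩
    have hE' : Ext {s} s st st₃ := (ext_enter hs _).trans hE
    have hF : Finished A G P Γ s st st₃ :=
      { start := hI
        fresh := hs
        loop := hL
        ext :=
          { hE' with
            -- The exception for `s` is void, because `s` was unseen in `st`.
            old_edges := fun a b ha _ hab =>
              hE'.old_edges a b ha (fun h => hs (Set.mem_singleton_iff.1 h ▸ ha)) hab }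
        disc := by
          rw [hE.disc s (enter_seen.ge (Set.mem_insert _ _)), enter_disc, discover_disc_self]
        explored := fun Y hY => hex Y (hfil Y hY) }
    refine ⟨_, Option.bind_eq_some_iff.2 ⟨(st₃, e), h1, rfl⟩, ?_⟩
    refine Finished.callPost ?_ hew hstep
    dsimp only
    split_ifs with hc
    · have hseen := seen_moveEwin hL.mem
      -- An accepting `s` was marked on entry. A winning choice could not be excluded, as marked
      -- states never win, so the loop would have refuted it with a losing successor.
      have hlost : ¬ Win (A.dfa.inter G) s := fun hw => by
        cases hw with
        | accept hacc => exact hc.2 (hL.inv.accept s hL.mem hacc)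
        | choose Y hY =>
          have hYe : Y ∉ ewinAgentChoices A s.1 := fun ⟨X, hX⟩ =>
            hew (succ A G s X Y) (hstep _ hP _) hX (hY X)
          obtain ⟨X, hX⟩ := he hc.1 Y (hfil Y hYe)
          exact hL.inv.ewin_sound _ hX (hY X)
      exact
        { hF with
          loop := hL.of_inv (hL.inv.of_seen_eq hseen subset_rfl (Set.subset_insert _ _)
            Set.sdiff_subset rfl rfl rfl hL.inv.awin_sound fun t ht => by
              rcases Set.mem_insert_iff.1 ht with rfl | ht
              · exact hlost
              · exact hL.inv.ewin_sound t ht) hseen rfl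
          ext := hF.ext.trans (.of_seen_eq _ _ hseen subset_rfl (Set.subset_insert _ _)
            rfl rfl rfl)
          explored := fun Y hY =>
            (hF.explored Y hY).mono (Set.subset_insert _ _) hseen.ge subset_rfl }
    · exact hF

theorem inv_init : Inv A G P ∅ (SearchState.init : SearchState (A.State × S₂)) where
  awin_sound _ h := absurd h (Set.notMem_empty _)
  ewin_sound _ h := absurd h (Set.notMem_empty _)
  accept s h := by simp [SearchState.seen, SearchState.init] at h
  explored s h := by simp [SearchState.seen, SearchState.init] at h
  edge_seen _ _ h := absurd h (Set.notMem_empty _)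
  seen_edge _ _ h := absurd h (Set.notMem_empty _)
  undet _ h := absurd h (Set.notMem_empty _)
  reachable s h := by simp [SearchState.seen, SearchState.init] at h
  disc_lt s h := by simp [SearchState.seen, SearchState.init] at h
  active := Set.empty_subset _

/-! ### Dependence on the recursion bound -/

theorem loopX_mono
    {f g : A.State × S₂ → SearchState (A.State × S₂) → Option (SearchState (A.State × S₂))}
    (hfg : ∀ s st r, f s st = some r → g s st = some r) (s : A.State × S₂) (Y : Finset O)
    (Xs : List (Finset I)) : ∀ st und r, loopX A G f s Y Xs st und = some r →
      loopX A G g s Y Xs st und = some r := by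
  induction Xs with
  | nil => exact fun _ _ _ h => h
  | cons X Xs ih =>
    intro st und r h
    rw [loopX] at h ⊢
    obtain ⟨st', h1, h2⟩ := Option.bind_eq_some_iff.1 h
    rw [hfg _ _ _ h1, Option.bind_some]
    split_ifs at h2 ⊢
    · exact h2
    · exact ih _ _ _ h2
    · exact ih _ _ _ h2

theorem loopY_mono
    {f g : A.State × S₂ → SearchState (A.State × S₂) → Option (SearchState (A.State × S₂))}
    (hfg : ∀ s st r, f s st = some r → g s st = some r)
    (ordX : A.State × S₂ → Finset O → List (Finset I)) (s : A.State × S₂)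
    (Ys : List (Finset O)) : ∀ st e r, loopY A G f ordX s Ys st e = some r →
      loopY A G g ordX s Ys st e = some r := by
  induction Ys with
  | nil => exact fun _ _ _ h => h
  | cons Y Ys ih =>
    intro st e r h
    rw [loopY] at h ⊢
    obtain ⟨st', h1, h2⟩ := Option.bind_eq_some_iff.1 h
    rw [loopX_mono hfg _ _ _ _ _ _ h1, Option.bind_some]
    split_ifs at h2 ⊢ <;> exact ih _ _ _ h2

/-- A larger bound can only turn `none` into an answer, so an answer obtained once is final. -/
theorem dfSearch_succ (ordY : A.State × S₂ → List (Finset O))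
    (ordX : A.State × S₂ → Finset O → List (Finset I)) (n : ℕ) :
    ∀ s st r, dfSearch A G ordY ordX n s st = some r →
      dfSearch A G ordY ordX (n + 1) s st = some r := by
  induction n with
  | zero => exact fun _ _ _ h => by simp [dfSearch] at h
  | succ n ih =>
    intro s st r h
    rw [dfSearch] at h ⊢
    by_cases hs : s ∈ st.awinState ∪ st.ewinState ∪ st.undetermined
    · rwa [if_pos hs] at h ⊢
    · rw [if_neg hs] at h ⊢
      obtain ⟨p, h1, h2⟩ := Option.bind_eq_some_iff.1 h
      exact Option.bind_eq_some_iff.2 ⟨p, loopY_mono ih _ _ _ _ _ _ h1, h2⟩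

theorem dfSearch_le (ordY : A.State × S₂ → List (Finset O))
    (ordX : A.State × S₂ → Finset O → List (Finset I)) {m n : ℕ} (hmn : m ≤ n)
    {s : A.State × S₂} {st r : SearchState (A.State × S₂)}
    (h : dfSearch A G ordY ordX m s st = some r) : dfSearch A G ordY ordX n s st = some r := by
  induction hmn with
  | refl => exact h
  | step _ ih => exact dfSearch_succ ordY ordX _ _ _ _ ih

/-- The search terminates, finds out whether the initial state is agent-winning, and explores
the agent-winning states that it finds completely. -/
theorem exists_dfSearch_eq [Finite I] [Finite A.State] [Finite S₂] (hstart : P A.dfa.start)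
    (hew : ∀ t : A.State × S₂, P t.1 → t.1 ∈ A.ew → ¬ Win (A.dfa.inter G) t)
    (hstep : ∀ a, P a → ∀ l, P (A.dfa.step a l))
    {ordY : A.State × S₂ → List (Finset O)} (hordY : ∀ s Y, Y ∈ ordY s)
    {ordX : A.State × S₂ → Finset O → List (Finset I)} (hordX : ∀ s Y X, X ∈ ordX s Y) :
    ∃ (N : ℕ) (st : SearchState (A.State × S₂)),
      (∀ n, N ≤ n → dfSearch A G ordY ordX n (A.dfa.start, G.start) SearchState.init = some st) ∧
      ((A.dfa.start, G.start) ∈ st.awinState ↔ Win (A.dfa.inter G) (A.dfa.start, G.start)) ∧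
      (∀ s ∈ st.awinState, P s.1 ∧ Win (A.dfa.inter G) s) ∧
      ∀ s ∈ st.awinState, ∀ Y, (∀ X, Win (A.dfa.inter G) (succ A G s X Y)) →
        ∀ X, succ A G s X Y ∈ st.awinState := by
  obtain ⟨st, h1, h2⟩ := dfSearch_spec (G := G) hew hstep hordY hordX
    ((SearchState.init : SearchState (A.State × S₂)).seenᶜ.ncard + 1) ∅
    (A.dfa.start, G.start) SearchState.init inv_init hstart (by simp) (Nat.lt_succ_self _)
  -- With no active call left, no state is undetermined.
  have hdet : ∀ t ∈ st.seen, Win (A.dfa.inter G) t → t ∈ st.awinState := fun t ht hw => by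
    rcases mem_seen.1 ht with h | h | h
    · exact h
    · exact absurd hw (h2.inv.ewin_sound t h)
    · obtain ⟨γ, hγ, -⟩ := h2.inv.undet t h
      exact absurd hγ (Set.notMem_empty _)
  refine ⟨_, st, fun n hn => dfSearch_le ordY ordX hn h1,
    ⟨h2.inv.awin_sound _, hdet _ h2.mem⟩, fun s hs =>
      ⟨h2.inv.reachable s (mem_seen.2 (.inl hs)), h2.inv.awin_sound s hs⟩, fun s hs Y hY X => ?_⟩
  have hs' : s ∈ st.seen := mem_seen.2 (.inl hs)
  have hYe : Y ∉ ewinAgentChoices A s.1 := fun ⟨X, hX⟩ =>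
    hew (succ A G s X Y) (hstep _ (h2.inv.reachable s hs') _) hX (hY X)
  rcases h2.inv.explored s hs' (Set.notMem_empty _) Y hYe with ⟨X, hX⟩ | hall
  · exact absurd (hY X) (h2.inv.ewin_sound _ hX)
  · exact hdet _ (hall X).1 (hY X)

end Search

/-! ### Attractors and words -/

/-- A simulation suffices: the agent copies its choices. -/
theorem Win.of_rel {S T : Type w} {G : DFA (Finset (I ⊕ O)) S} {H : DFA (Finset (I ⊕ O)) T}
    {R : S → T → Prop} (hstep : ∀ s t, R s t → ∀ a, R (G.step s a) (H.step t a))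
    (hacc : ∀ s t, R s t → s ∈ G.accept → t ∈ H.accept) {s : S} (hs : Win G s) :
    ∀ t, R s t → Win H t := by
  induction hs with
  | accept h => exact fun t ht => .accept (hacc _ t ht h)
  | choose Y _ ih => exact fun t ht => .choose Y fun X => ih X _ (hstep _ t ht _)

theorem Win.fst {S T : Type w} {G : DFA (Finset (I ⊕ O)) S} {H : DFA (Finset (I ⊕ O)) T}
    {p : S × T} (h : Win (G.inter H) p) : Win G p.1 :=
  h.of_rel (R := fun p s => p.1 = s) (fun _ _ h _ => h ▸ rfl) (fun _ _ h h' => h ▸ h'.1) _ rfl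

/-- Let the environment always answer `∅`. This shows that states with empty language, in particular
those marked `ew`, do not win. -/
theorem Win.exists_evalFrom_mem {S : Type w} {G : DFA (Finset (I ⊕ O)) S} {s : S}
    (h : Win G s) : ∃ ρ, G.evalFrom s ρ ∈ G.accept := by
  induction h with
  | accept h => exact ⟨[], h⟩
  | choose Y _ ih =>
    obtain ⟨ρ, hρ⟩ := ih ∅
    exact ⟨letter ∅ Y :: ρ, hρ⟩

/-! ### Regions -/

section RegionOf

variable {S : Type w} [Finite S] {G : DFA (Finset (I ⊕ O)) S} {W : Set S}

theorem regionOf_step_of_forall {s : W} {a : Finset (I ⊕ O)}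
    (h : ∀ X, G.step s (letter X a.toRight) ∈ W) :
    ∃ h', (regionOf G W).dfa.step (some s) a = some ⟨G.step s a, h'⟩ :=
  ⟨_, dif_pos h⟩

theorem regionOf_step_of_not_forall {s : W} {a : Finset (I ⊕ O)}
    (h : ¬ ∀ X, G.step s (letter X a.toRight) ∈ W) :
    (regionOf G W).dfa.step (some s) a = none :=
  dif_neg h

theorem some_mem_regionOf_accept {s : W} :
    some s ∈ (regionOf G W).dfa.accept ↔ (s : S) ∈ G.accept :=
  ⟨fun ⟨_, ht, h⟩ => Option.some_injective _ ht ▸ h, fun h => ⟨s, rfl, h⟩⟩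

theorem none_notMem_regionOf_accept : none ∉ (regionOf G W).dfa.accept :=
  fun ⟨_, h, _⟩ => by cases h

theorem regionOf_evalFrom_none (ρ : List (Finset (I ⊕ O))) :
    (regionOf G W).dfa.evalFrom none ρ = none := by
  induction ρ with
  | nil => rfl
  | cons a ρ ih => exact ih

theorem regionOf_evalFrom_none_notMem (ρ : List (Finset (I ⊕ O))) :
    (regionOf G W).dfa.evalFrom none ρ ∉ (regionOf G W).dfa.accept := by
  rw [regionOf_evalFrom_none]
  exact none_notMem_regionOf_accept

theorem awr_step_of_forall {s : awin G} {a : Finset (I ⊕ O)}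
    (h : ∀ X, G.step s (letter X a.toRight) ∈ awin G) :
    ∃ h', (awr G).dfa.step (some s) a = some ⟨G.step s a, h'⟩ :=
  regionOf_step_of_forall h

theorem awr_step_of_not_forall {s : awin G} {a : Finset (I ⊕ O)}
    (h : ¬ ∀ X, G.step s (letter X a.toRight) ∈ awin G) :
    (awr G).dfa.step (some s) a = none :=
  regionOf_step_of_not_forall h

theorem letter_toLeft_toRight (a : Finset (I ⊕ O)) : letter a.toLeft a.toRight = a :=
  Finset.toLeft_disjSum_toRight

theorem toRight_letter (X : Finset I) (Y : Finset O) : (letter X Y).toRight = Y :=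
  Finset.toRight_disjSum

end RegionOf

/-! ### Products with an agent-winning region -/

section AwrInter

variable {S₁ S₂ : Type w} [Finite S₁] {G₁ : DFA (Finset (I ⊕ O)) S₁}
  {G₂ : DFA (Finset (I ⊕ O)) S₂}

/-- The sink `ew` is not accepting and never left, so it cannot win; all other transitions of the
region are those of `G₁`. -/
theorem Win.of_awr_inter {p : (awr G₁).State × S₂} (h : Win ((awr G₁).dfa.inter G₂) p) :
    ∃ s : awin G₁, p.1 = some s ∧ Win (G₁.inter G₂) (s, p.2) := by
  induction h with
  | @accept p h =>
    obtain ⟨⟨s, hs, hacc⟩, h2⟩ := h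
    exact ⟨s, hs, .accept ⟨hacc, h2⟩⟩
  | @choose p Y _ ih =>
    obtain ⟨b, s₂⟩ := p
    cases b with
    | none =>
      obtain ⟨s, hs, -⟩ := ih ∅
      cases hs
    | some s =>
      refine ⟨s, rfl, .choose Y fun X => ?_⟩
      obtain ⟨t, ht, hw⟩ := ih X
      have ht : (awr G₁).dfa.step (some s) (letter X Y) = some t := ht
      by_cases hc : ∀ X', G₁.step s (letter X' (letter X Y).toRight) ∈ awin G₁
      · obtain ⟨h', hstep⟩ := regionOf_step_of_forall hc
        obtain rfl := Option.some_injective _ (ht.symm.trans hstep)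
        exact hw
      · cases ht.symm.trans (regionOf_step_of_not_forall hc)

/-- Under a winning choice of the product all successors project into `awin G₁`, so the region keeps
these transitions. -/
theorem Win.awr_inter {p : S₁ × S₂} (h : Win (G₁.inter G₂) p) (h₁ : p.1 ∈ awin G₁) :
    Win ((awr G₁).dfa.inter G₂) (some ⟨p.1, h₁⟩, p.2) := by
  induction h with
  | accept h => exact .accept ⟨⟨_, rfl, h.1⟩, h.2⟩
  | @choose p Y hY ih =>
    have hmem : ∀ X, G₁.step p.1 (letter X Y) ∈ awin G₁ := fun X => (hY X).fst.mem_awin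
    refine .choose Y fun X => ?_
    obtain ⟨h', hstep⟩ := awr_step_of_forall (G := G₁) (s := ⟨p.1, h₁⟩)
      (a := letter X Y) (by rwa [toRight_letter])
    have := ih X h'
    change Win _ ((awr G₁).dfa.step (some ⟨p.1, h₁⟩) (letter X Y), _)
    rw [hstep]
    exact this

end AwrInter

/-! ### Minimization -/

namespace Region

/-- The class of a reachable state. -/
def cls (A : Region.{u, v, w} I O) (s : A.Reachable) : A.minimize.State :=
  Quotient.mk A.nerode s

/-- The state that is reached by the word `ρ`. -/
def evalReachable (A : Region.{u, v, w} I O) (ρ : List (Finset (I ⊕ O))) : A.Reachable :=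
  ⟨A.dfa.eval ρ, ρ, rfl⟩

theorem minimize_eval (A : Region.{u, v, w} I O) (ρ : List (Finset (I ⊕ O))) :
    A.minimize.dfa.eval ρ = A.cls (A.evalReachable ρ) := by
  induction ρ using List.reverseRecOn with
  | nil => rfl
  | append_singleton ρ a ih =>
    have h : A.evalReachable (ρ ++ [a]) =
        ⟨A.dfa.step (A.dfa.eval ρ) a, ρ ++ [a], DFA.eval_append_singleton ..⟩ :=
      Subtype.ext (DFA.eval_append_singleton ..)
    rw [DFA.eval_append_singleton, ih, h]
    rfl

theorem minimize_eval_surjective (A : Region.{u, v, w} I O) :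
    Function.Surjective A.minimize.dfa.eval := by
  rintro ⟨s, ρ, rfl⟩
  exact ⟨ρ, A.minimize_eval ρ⟩

theorem cls_eq_cls {A : Region.{u, v, w} I O} {s t : A.Reachable} :
    A.cls s = A.cls t ↔
      A.dfa.acceptsFrom s.1 = A.dfa.acceptsFrom t.1 :=
  Quotient.eq (r := A.nerode)

theorem cls_mem_minimize_accept {A : Region.{u, v, w} I O} {s : A.Reachable} :
    A.cls s ∈ A.minimize.dfa.accept ↔ s.1 ∈ A.dfa.accept := by
  refine ⟨fun ⟨t, hst, ht⟩ => ?_, fun h => ⟨s, rfl, h⟩⟩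
  have h : [] ∈ A.dfa.acceptsFrom t.1 := ht
  rwa [← cls_eq_cls.1 hst] at h

/-- Every state of a minimization is reached by a word, so this Nerode criterion allows
minimizations to be compared through words alone. -/
theorem minimize_eval_eq_iff {A : Region.{u, v, w} I O} {ρ σ : List (Finset (I ⊕ O))} :
    A.minimize.dfa.eval ρ = A.minimize.dfa.eval σ ↔
      ∀ τ, A.dfa.eval (ρ ++ τ) ∈ A.dfa.accept ↔ A.dfa.eval (σ ++ τ) ∈ A.dfa.accept := by
  rw [minimize_eval, minimize_eval, cls_eq_cls]
  simp only [evalReachable, DFA.eval, DFA.evalFrom_of_append]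
  exact Set.ext_iff

/-- One marked member marks the whole class, hence the detour through an equivalent word `σ`. -/
theorem minimize_eval_mem_ew {A : Region.{u, v, w} I O} {ρ : List (Finset (I ⊕ O))} :
    A.minimize.dfa.eval ρ ∈ A.minimize.ew ↔
      ∃ σ, A.minimize.dfa.eval ρ = A.minimize.dfa.eval σ ∧ A.dfa.eval σ ∈ A.ew := by
  constructor
  · rintro ⟨⟨_, σ, rfl⟩, h, hs⟩
    exact ⟨σ, h.trans (A.minimize_eval σ).symm, hs⟩
  · rintro ⟨σ, h, hs⟩
    exact ⟨_, h.trans (A.minimize_eval σ), hs⟩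

/-- Regions in which every word leads to the same answers have isomorphic minimizations. -/
theorem minimize_iso {A : Region.{u, v, w} I O} {B : Region.{u, v, x} I O}
    (hacc : ∀ ρ, A.dfa.eval ρ ∈ A.dfa.accept ↔ B.dfa.eval ρ ∈ B.dfa.accept)
    (hew : ∀ ρ, A.dfa.eval ρ ∈ A.ew ↔ B.dfa.eval ρ ∈ B.ew) : A.minimize.Iso B.minimize := by
  have heq : ∀ ρ σ, A.minimize.dfa.eval ρ = A.minimize.dfa.eval σ ↔
      B.minimize.dfa.eval ρ = B.minimize.dfa.eval σ := fun ρ σ => by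
    simp only [minimize_eval_eq_iff, hacc]
  let f : A.minimize.State → B.minimize.State := fun q =>
    B.minimize.dfa.eval (Function.surjInv A.minimize_eval_surjective q)
  have hf : ∀ ρ, f (A.minimize.dfa.eval ρ) = B.minimize.dfa.eval ρ := fun ρ =>
    (heq _ _).1 (Function.surjInv_eq A.minimize_eval_surjective _)
  have hbij : Function.Bijective f := by
    refine ⟨fun p q hpq => ?_, fun q => ?_⟩
    · obtain ⟨ρ, rfl⟩ := A.minimize_eval_surjective p
      obtain ⟨σ, rfl⟩ := A.minimize_eval_surjective q
      rw [hf, hf] at hpq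
      exact (heq _ _).2 hpq
    · obtain ⟨ρ, rfl⟩ := B.minimize_eval_surjective q
      exact ⟨_, hf ρ⟩
  refine ⟨Equiv.ofBijective f hbij, hf [], fun q a => ?_, fun q => ?_, fun q => ?_⟩ <;>
    obtain ⟨ρ, rfl⟩ := A.minimize_eval_surjective q <;>
    simp only [Equiv.ofBijective_apply]
  · rw [← DFA.eval_append_singleton, hf, hf, DFA.eval_append_singleton]
  · rw [hf, minimize_eval, minimize_eval, cls_mem_minimize_accept, cls_mem_minimize_accept]
    exact (hacc ρ).symm
  · rw [hf, minimize_eval_mem_ew, minimize_eval_mem_ew]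
    simp only [heq, hew]

end Region

/-! ### Regions in place of a game -/

/-- A relation between the states of a region and those of another one that respects the initial
states, the transitions and the accepting states, such that no word is accepted from a related state
that is marked `ew`. -/
structure Bisim (A : Region.{u, v, w} I O) (B : Region.{u, v, w} I O)
    (R : A.State → B.State → Prop) : Prop where
  start : R A.dfa.start B.dfa.start
  step : ∀ a b, R a b → ∀ l, R (A.dfa.step a l) (B.dfa.step b l)
  accept : ∀ a b, R a b → (a ∈ A.dfa.accept ↔ b ∈ B.dfa.accept)
  ew : ∀ a b, R a b → a ∈ A.ew → ∀ ρ, A.dfa.evalFrom a ρ ∉ A.dfa.accept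

theorem Bisim.evalFrom_mem_accept {A B : Region.{u, v, w} I O} {R : A.State → B.State → Prop}
    (hstep : ∀ a b, R a b → ∀ l, R (A.dfa.step a l) (B.dfa.step b l))
    (hacc : ∀ a b, R a b → (a ∈ A.dfa.accept ↔ b ∈ B.dfa.accept)) (ρ : List (Finset (I ⊕ O))) :
    ∀ a b, R a b → (A.dfa.evalFrom a ρ ∈ A.dfa.accept ↔ B.dfa.evalFrom b ρ ∈ B.dfa.accept) := by
  induction ρ with
  | nil => exact hacc
  | cons l ρ ih => exact fun a b hab => ih _ _ (hstep a b hab l)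

theorem bisim_refl {S : Type w} [Finite S] (G : DFA (Finset (I ⊕ O)) S) (W : Set S) :
    Bisim (regionOf G W) (regionOf G W) (fun a b => a = b) where
  start := rfl
  step _ _ h _ := h ▸ rfl
  accept _ _ h := h ▸ Iff.rfl
  ew a _ _ ha ρ := by
    obtain rfl : a = none := ha
    exact regionOf_evalFrom_none_notMem ρ

/-- Reachable states are related if the isomorphism matches their classes. The partner of a marked
state need not be `none`, but it shares a class with `none`, so its language is empty; `Bisim` asks
for no more. -/
theorem exists_bisim_of_minimize_iso {S : Type w} [Finite S] {G : DFA (Finset (I ⊕ O)) S}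
    {W : Set S} {A : Region.{u, v, w} I O} (h : A.minimize.Iso (regionOf G W).minimize) :
    ∃ R, Bisim A (regionOf G W) R := by
  obtain ⟨e, hstart, hstep, hacc, hew⟩ := h
  let B : Region.{u, v, w} I O := regionOf G W
  let R : A.State → B.State → Prop := fun a b =>
    ∃ (a' : A.Reachable) (b' : B.Reachable), a'.1 = a ∧ b'.1 = b ∧
      e (A.cls a') = B.cls b'
  have hRs : ∀ a b, R a b → ∀ l, R (A.dfa.step a l) (B.dfa.step b l) := by
    rintro _ _ ⟨⟨_, ρ, rfl⟩, ⟨_, σ, rfl⟩, rfl, rfl, hab⟩ l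
    refine ⟨A.evalReachable (ρ ++ [l]), B.evalReachable (σ ++ [l]),
      DFA.eval_append_singleton .., DFA.eval_append_singleton .., ?_⟩
    have hab : e (A.cls (A.evalReachable ρ)) =
      B.cls (B.evalReachable σ) := hab
    rw [← Region.minimize_eval, ← Region.minimize_eval] at hab ⊢
    rw [DFA.eval_append_singleton, DFA.eval_append_singleton, hstep, hab]
  have hRa : ∀ a b, R a b → (a ∈ A.dfa.accept ↔ b ∈ B.dfa.accept) := by
    rintro _ _ ⟨a, b, rfl, rfl, hab⟩
    rw [← Region.cls_mem_minimize_accept, ← Region.cls_mem_minimize_accept, ← hab]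
    exact (hacc _).symm
  refine ⟨R, ⟨⟨_, [], rfl⟩, ⟨_, [], rfl⟩, rfl, rfl, hstart⟩, hRs, hRa, ?_⟩
  intro a b hR ha ρ
  rw [Bisim.evalFrom_mem_accept hRs hRa ρ a b hR]
  obtain ⟨a, b, rfl, rfl, hab⟩ := hR
  have hmem : e (A.cls a) ∈ B.minimize.ew := (hew _).2 ⟨a, rfl, ha⟩
  rw [hab] at hmem
  obtain ⟨c, hbc, hc⟩ := hmem
  have hc : c.1 = none := hc
  have hbc := Region.cls_eq_cls.1 hbc
  rw [hc] at hbc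
  intro hρ
  have hρ : ρ ∈ B.dfa.acceptsFrom b.1 := hρ
  rw [hbc] at hρ
  exact regionOf_evalFrom_none_notMem ρ hρ

/-! ### Lockstep of the two regions -/

section Corresponds

variable {S₁ S₂ : Type w} [Finite S₁] {G₁ : DFA (Finset (I ⊕ O)) S₁}
  {G₂ : DFA (Finset (I ⊕ O)) S₂} {A : Region.{u, v, w} I O}
  {R : A.State → (awr G₁).State → Prop}

theorem Bisim.not_win_of_mem_ew (hR : Bisim A (awr G₁) R) (t : A.State × S₂)
    (ht : ∃ b, R t.1 b) (hew : t.1 ∈ A.ew) : ¬ Win (A.dfa.inter G₂) t := fun h => by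
  obtain ⟨b, hb⟩ := ht
  obtain ⟨ρ, hρ⟩ := h.fst.exists_evalFrom_mem
  exact hR.ew _ b hb hew ρ hρ

theorem Bisim.win_inter_iff (hR : Bisim A (awr G₁) R) {a : A.State} {b : (awr G₁).State}
    (hab : R a b) {s₂ : S₂} : Win (A.dfa.inter G₂) (a, s₂) ↔
      ∃ s : awin G₁, b = some s ∧ Win (G₁.inter G₂) (s, s₂) := by
  constructor
  · intro h
    exact (Win.of_rel (G := A.dfa.inter G₂) (H := (awr G₁).dfa.inter G₂) (R := fun p q => R p.1 q.1 ∧ p.2 = q.2)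
      (fun p q hpq l => ⟨hR.step _ _ hpq.1 l, congrArg (G₂.step · l) hpq.2⟩)
      (fun p q hpq hp => ⟨(hR.accept _ _ hpq.1).1 hp.1, hpq.2 ▸ hp.2⟩)
      h (b, s₂) ⟨hab, rfl⟩).of_awr_inter
  · rintro ⟨s, rfl, h⟩
    exact Win.of_rel (G := (awr G₁).dfa.inter G₂) (H := A.dfa.inter G₂) (R := fun p q => R q.1 p.1 ∧ p.2 = q.2)
      (fun p q hpq l => ⟨hR.step _ _ hpq.1 l, congrArg (G₂.step · l) hpq.2⟩)
      (fun p q hpq hp => ⟨(hR.accept _ _ hpq.1).2 hp.1, hpq.2 ▸ hp.2⟩)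
      (h.awr_inter s.2) (a, s₂) ⟨hab, rfl⟩

/-- The correspondence between the states of a region of `A × G₂` and those of the agent-winning
region of `G₁ × G₂`. -/
inductive Corr (G₂ : DFA (Finset (I ⊕ O)) S₂) (R : A.State → (awr G₁).State → Prop)
    (W : Set (A.State × S₂)) : Option W → Option (awin (G₁.inter G₂)) → Prop
  | ew : Corr G₂ R W none none
  | win {a : A.State} {s₁ : awin G₁} {s₂ : S₂} (h : (a, s₂) ∈ W)
      (h' : ((s₁ : S₁), s₂) ∈ awin (G₁.inter G₂)) (hR : R a (some s₁)) :
      Corr G₂ R W (some ⟨(a, s₂), h⟩) (some ⟨(s₁, s₂), h'⟩)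

variable {W : Set (A.State × S₂)}

theorem Bisim.exists_corr (hR : Bisim A (awr G₁) R) {p : A.State × S₂} (hp : p ∈ W)
    {b : (awr G₁).State} (hb : R p.1 b) (hw : Win (A.dfa.inter G₂) p) :
    ∃ d', Corr G₂ R W (some ⟨p, hp⟩) d' := by
  obtain ⟨a, s₂⟩ := p
  obtain ⟨s, rfl, hs⟩ := (hR.win_inter_iff hb).1 hw
  exact ⟨_, .win hp hs.mem_awin hb⟩

theorem Corr.mem_accept [Finite S₂] [Finite A.State] (hR : Bisim A (awr G₁) R)
    {d : Option W} {d' : Option (awin (G₁.inter G₂))} (h : Corr G₂ R W d d') :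
    d ∈ (regionOf (A.dfa.inter G₂) W).dfa.accept ↔ d' ∈ (awr (G₁.inter G₂)).dfa.accept := by
  cases h with
  | ew => exact iff_of_false none_notMem_regionOf_accept none_notMem_regionOf_accept
  | win _ _ h =>
    refine some_mem_regionOf_accept.trans (Iff.trans ?_ some_mem_regionOf_accept.symm)
    exact and_congr_left' ((hR.accept _ _ h).trans some_mem_regionOf_accept)

theorem Corr.eq_none_iff {d : Option W} {d' : Option (awin (G₁.inter G₂))}
    (h : Corr G₂ R W d d') : d = none ↔ d' = none := by
  cases h <;> simp

/-- A choice is safe on both sides or on neither. If it is safe in `G₁ × G₂`, its successors win in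
`A × G₂` and `hclosed` puts them into `W`; conversely, `W` contains winning states only. -/
theorem Corr.step [Finite S₂] [Finite A.State] (hR : Bisim A (awr G₁) R)
    (hW : ∀ p ∈ W, Win (A.dfa.inter G₂) p)
    (hclosed : ∀ p ∈ W, ∀ Y, (∀ X, Win (A.dfa.inter G₂) (succ A G₂ p X Y)) →
      ∀ X, succ A G₂ p X Y ∈ W)
    {d : Option W} {d' : Option (awin (G₁.inter G₂))} (h : Corr G₂ R W d d')
    (l : Finset (I ⊕ O)) :
    Corr G₂ R W ((regionOf (A.dfa.inter G₂) W).dfa.step d l)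
      ((awr (G₁.inter G₂)).dfa.step d' l) := by
  cases h with
  | ew => exact .ew
  | @win a s₁ s₂ h h' hab =>
    by_cases hc : ∀ X, (G₁.inter G₂).step (s₁, s₂) (letter X l.toRight) ∈ awin (G₁.inter G₂)
    · have hmem : ∀ X, G₁.step s₁ (letter X l.toRight) ∈ awin G₁ := fun X =>
        (win_of_mem_awin (hc X)).fst.mem_awin
      have hrel : ∀ X, ∃ s' : awin G₁, (s' : S₁) = G₁.step s₁ (letter X l.toRight) ∧
          R (A.dfa.step a (letter X l.toRight)) (some s') := fun X => by
        obtain ⟨h1, h2⟩ := awr_step_of_forall (G := G₁) (s := s₁)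
          (a := letter X l.toRight) (by rwa [toRight_letter])
        refine ⟨⟨_, h1⟩, rfl, ?_⟩
        have := hR.step _ _ hab (letter X l.toRight)
        rwa [h2] at this
      have hcW : ∀ X, (A.dfa.inter G₂).step (a, s₂) (letter X l.toRight) ∈ W := by
        refine hclosed _ h _ fun X => ?_
        obtain ⟨s', hs', hrs⟩ := hrel X
        refine (hR.win_inter_iff hrs).2 ⟨s', rfl, ?_⟩
        rw [hs']
        exact win_of_mem_awin (hc X)
      obtain ⟨h1, h2⟩ := regionOf_step_of_forall (s := ⟨(a, s₂), h⟩) hcW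
      obtain ⟨h3, h4⟩ := awr_step_of_forall (s := ⟨((s₁ : S₁), s₂), h'⟩) hc
      rw [h2, h4]
      -- The successor under `l` itself is the instance `X = l.toLeft`.
      obtain ⟨⟨s', h5⟩, hs', hrs⟩ := hrel l.toLeft
      rw [letter_toLeft_toRight] at hs' hrs
      cases hs'
      exact .win (s₁ := ⟨_, h5⟩) h1 h3 hrs
    · have hcW : ¬ ∀ X, (A.dfa.inter G₂).step (a, s₂) (letter X l.toRight) ∈ W := fun hcW => by
        refine hc fun X => ?_
        obtain ⟨s', hs', hw⟩ := (hR.win_inter_iff (hR.step _ _ hab _)).1 (hW _ (hcW X))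
        by_cases hm : ∀ X', G₁.step s₁ (letter X' (letter X l.toRight).toRight) ∈ awin G₁
        · obtain ⟨h1, h2⟩ := regionOf_step_of_forall hm
          obtain rfl := Option.some_injective _ (hs'.symm.trans h2)
          exact hw.mem_awin
        · cases hs'.symm.trans (regionOf_step_of_not_forall hm)
      rw [regionOf_step_of_not_forall (s := ⟨(a, s₂), h⟩) hcW,
        awr_step_of_not_forall (s := ⟨((s₁ : S₁), s₂), h'⟩) hc]
      exact .ew

theorem Bisim.corr_start [Finite S₂] [Finite A.State] (hR : Bisim A (awr G₁) R)
    (hW : ∀ p ∈ W, Win (A.dfa.inter G₂) p) (hs : (A.dfa.start, G₂.start) ∈ W) :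
    Corr G₂ R W (regionOf (A.dfa.inter G₂) W).dfa.start (awr (G₁.inter G₂)).dfa.start := by
  obtain ⟨s, hs1, hw⟩ := (hR.win_inter_iff hR.start).1 (hW _ hs)
  have h1 : G₁.start ∈ awin G₁ := by
    by_contra hc
    cases hs1.symm.trans (dif_neg hc)
  have h2 : (awr G₁).dfa.start = some ⟨G₁.start, h1⟩ := dif_pos h1
  obtain rfl := Option.some_injective _ (hs1.symm.trans h2)
  have h3 : (regionOf (A.dfa.inter G₂) W).dfa.start = some ⟨(A.dfa.start, G₂.start), hs⟩ :=
    dif_pos hs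
  have h4 : (awr (G₁.inter G₂)).dfa.start = some ⟨(G₁.start, G₂.start), hw.mem_awin⟩ :=
    dif_pos hw.mem_awin
  rw [h3, h4]
  exact .win (s₁ := ⟨G₁.start, h1⟩) hs hw.mem_awin (hs1 ▸ hR.start)

theorem Bisim.minimize_iso_awr [Finite S₂] [Finite A.State] (hR : Bisim A (awr G₁) R)
    (hW : ∀ p ∈ W, Win (A.dfa.inter G₂) p)
    (hclosed : ∀ p ∈ W, ∀ Y, (∀ X, Win (A.dfa.inter G₂) (succ A G₂ p X Y)) →
      ∀ X, succ A G₂ p X Y ∈ W) (hs : (A.dfa.start, G₂.start) ∈ W) :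
    (regionOf (A.dfa.inter G₂) W).minimize.Iso (awr (G₁.inter G₂)).minimize := by
  have hcorr : ∀ ρ, Corr G₂ R W ((regionOf (A.dfa.inter G₂) W).dfa.eval ρ)
      ((awr (G₁.inter G₂)).dfa.eval ρ) := by
    intro ρ
    induction ρ using List.reverseRecOn with
    | nil => exact hR.corr_start hW hs
    | append_singleton ρ l ih =>
      rw [DFA.eval_append_singleton, DFA.eval_append_singleton]
      exact ih.step hR hW hclosed l
  exact Region.minimize_iso (fun ρ => (hcorr ρ).mem_accept hR) fun ρ => (hcorr ρ).eq_none_iff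

end Corresponds

/-! ### The embedding before minimization -/

section Embeds

variable {S₁ S₂ : Type w} [Finite S₁] {G₁ : DFA (Finset (I ⊕ O)) S₁}
  {G₂ : DFA (Finset (I ⊕ O)) S₂} {W : Set ((awr G₁).State × S₂)}

/-- A state of `awr (G₁ × G₂)` as a state of `awr G₁ × G₂`. -/
def awinInterEmb (q : awin (G₁.inter G₂)) : (awr G₁).State × S₂ :=
  (some ⟨q.1.1, (win_of_mem_awin q.2).fst.mem_awin⟩, q.1.2)

theorem awinInterEmb_injective :
    Function.Injective (awinInterEmb : awin (G₁.inter G₂) → (awr G₁).State × S₂) := by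
  rintro ⟨⟨a, b⟩, h⟩ ⟨⟨a', b'⟩, h'⟩ heq
  obtain ⟨h1, rfl⟩ := Prod.ext_iff.1 heq
  cases Option.some_injective _ h1
  rfl

theorem Corr.map_eq {d : Option W} {d' : Option (awin (G₁.inter G₂))}
    (h : Corr G₂ (A := awr G₁) (fun a b => a = b) W d d') :
    d.map Subtype.val = d'.map awinInterEmb := by
  cases h with
  | ew => rfl
  | win _ _ h => cases h; rfl

/-- With equality as the relation, `Corr` is the graph of an injective function: corresponding
states are the same state of `awr G₁ × G₂`, or both are `ew` (`Corr.map_eq`). -/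
theorem regionOf_embeds_awr [Finite S₂] [Finite (awr G₁).State]
    (hW : ∀ p ∈ W, Win ((awr G₁).dfa.inter G₂) p)
    (hclosed : ∀ p ∈ W, ∀ Y, (∀ X, Win ((awr G₁).dfa.inter G₂) (succ (awr G₁) G₂ p X Y)) →
      ∀ X, succ (awr G₁) G₂ p X Y ∈ W) (hs : ((awr G₁).dfa.start, G₂.start) ∈ W) :
    (regionOf ((awr G₁).dfa.inter G₂) W).Embeds (awr (G₁.inter G₂)) := by
  have hR : Bisim (awr G₁) (awr G₁) (fun a b => a = b) := bisim_refl G₁ (awin G₁)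
  have hex : ∀ d : Option W, ∃ d', Corr G₂ (G₁ := G₁) (A := awr G₁) (fun a b => a = b) W d d'
    | none => ⟨none, .ew⟩
    | some ⟨p, hp⟩ => hR.exists_corr hp rfl (hW p hp)
  choose f hf using hex
  have huniq : ∀ {d d'}, Corr G₂ (G₁ := G₁) (A := awr G₁) (fun a b => a = b) W d d' →
      f d = d' := fun {d d'} h =>
    Option.map_injective awinInterEmb_injective ((hf d).map_eq.symm.trans h.map_eq)
  refine ⟨f, fun d₁ d₂ h => Option.map_injective Subtype.val_injective ?_,
    huniq (hR.corr_start hW hs), fun d l => huniq ((hf d).step hR hW hclosed l),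
    fun d => ((hf d).mem_accept hR).symm, fun d => (hf d).eq_none_iff.symm⟩
  rw [(hf d₁).map_eq, (hf d₂).map_eq, h]

end Embeds

end LTLfSynthesis

end

/-! ### Correctness of the procedure -/

theorem mainTheorem5 {I : Type u} {O : Type v} [Finite I] [Finite O]
    {S₁ S₂ : Type w} [Finite S₁] [Finite S₂]
    (ψ₁ ψ₂ : LTLf (I ⊕ O))
    (G₁ : DFA (Finset (I ⊕ O)) S₁) (G₂ : DFA (Finset (I ⊕ O)) S₂)
    (hG₁ : Recognizes G₁ ψ₁) (hG₂ : Recognizes G₂ ψ₂)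
    (hstart : ¬ (G₁.start ∈ G₁.accept ∧ G₂.start ∈ G₂.accept))
    -- the input is the agent-winning region of `G₁`, in any form with the same minimization
    (A : Region.{u, v, w} I O) (hA : A.minimize.Iso (awr G₁).minimize)
    -- arbitrary orders in which the loops run through the agent and environment choices
    (ordY : A.State × S₂ → List (Finset O)) (hordY : ∀ s Y, Y ∈ ordY s)
    (ordX : A.State × S₂ → Finset O → List (Finset I)) (hordX : ∀ s Y X, X ∈ ordX s Y) :
    (Realizable (LTLf.and ψ₁ ψ₂) →
      ∃ (N : ℕ) (M : Region.{u, v, w} I O), (∀ n, N ≤ n → compose A G₂ ordY ordX n = some (some M)) ∧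
        M.Iso (awr (G₁.inter G₂)).minimize) ∧
    (¬ Realizable (LTLf.and ψ₁ ψ₂) →
      ∃ N : ℕ, ∀ n, N ≤ n → compose A G₂ ordY ordX n = some none) ∧
    (A = awr G₁ → Realizable (LTLf.and ψ₁ ψ₂) →
      ∃ (N : ℕ) (D : Region.{u, v, w} I O), (∀ n, N ≤ n → composeBuild A G₂ ordY ordX n = some (some D)) ∧
        D.Embeds (awr (G₁.inter G₂))) := by
  have := A.finite
  obtain ⟨R, hR⟩ : ∃ R, Bisim A (awr G₁) R := exists_bisim_of_minimize_iso hA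
  -- The predicate `P` confines the search to related states of `A`; on unreachable states the marks
  -- of `A` may be arbitrary.
  obtain ⟨N, st, hrun, hinit, hsound, hclosed⟩ := exists_dfSearch_eq (G := G₂)
    (P := fun a => ∃ b, R a b) ⟨_, hR.start⟩ hR.not_win_of_mem_ew
    (fun a ⟨b, hab⟩ l => ⟨_, hR.step a b hab l⟩) hordY hordX
  have hW := fun p hp => (hsound p hp).2
  have hreal : Realizable (LTLf.and ψ₁ ψ₂) ↔ (A.dfa.start, G₂.start) ∈ st.awinState := by
    rw [realizable_iff (hG₁.inter hG₂) hstart, mem_awin_iff, hinit, hR.win_inter_iff hR.start]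
    constructor
    · intro h
      exact ⟨⟨_, h.fst.mem_awin⟩, dif_pos h.fst.mem_awin, h⟩
    · rintro ⟨s, hs, hw⟩
      have h1 : G₁.start ∈ awin G₁ := by
        by_contra hc
        cases hs.symm.trans (dif_neg hc)
      obtain rfl := Option.some_injective _ (hs.symm.trans (dif_pos h1))
      exact hw
  refine ⟨fun h => ?_, fun h => ?_, fun hAeq h => ?_⟩ <;> rw [hreal] at h
  · refine ⟨N, (buildAwr A G₂ st.awinState).minimize, fun n hn => ?_,
      hR.minimize_iso_awr hW hclosed h⟩
    rw [compose, composeBuild, hrun n hn, Option.map_some, if_pos h]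
    rfl
  · refine ⟨N, fun n hn => ?_⟩
    rw [compose, composeBuild, hrun n hn, Option.map_some, if_neg h]
    rfl
  · refine ⟨N, buildAwr A G₂ st.awinState, fun n hn => ?_, ?_⟩
    · rw [composeBuild, hrun n hn, Option.map_some, if_pos h]
    · subst hAeq
      exact regionOf_embeds_awr hW hclosed h
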